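/- All graphs are finite, simple and undirected. $\chi(G)$ and $\omega(G)$ denote the chromatic number and the clique number of $G$; $P_n$ and $K_n$ are the path and the complete graph on $n$ vertices; $G_1\cup G_2$ is the disjoint union of graphs and $G_1+G_2$ is their join (the disjoint union together with all edges between $G_1$ and $G_2$). A graph is $\{H_1,H_2\}$-free if it has no induced subgraph isomorphic to $H_1$ or to $H_2$. Theorem. Let $p\ge 2$ be an integer. The class of $\{P_3\cup P_2,\,(K_1\cup K_2)+K_p\}$-free graphs has a linear $\chi$-binding function, that is, there are constants $a,b$ depending only on $p$ such that $\chi(G)\le a\,\omega(G)+b$ for every graph $G$ in the class. More precisely, every $\{P_3\cup P_2,\,(K_1\cup K_2)+K_p\}$-free graph $G$ satisfies $$ \chi(G)\le \begin{cases} \omega(G)+\displaystyle\sum_{j=2}^{p+1}(j-1)(p-j+3) & \text{if } 3\le\omega(G)\le p+1,\\[2ex] \omega(G)+7(p-1)+\displaystyle\sum_{j=4}^{p-\lfloor k/2\rfloor}(j-1)(p-j+3) & \text{if } \omega(G)=p+2+k \text{ with } k \text{ an integer},\ 0\le k\le 2p-5,\\[2ex] \omega(G)+4p-3 & \text{if }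 \omega(G)=3p-2,\\[1ex] \omega(G)+p-1 & \text{if } \omega(G)\ge 3p-1, \end{cases} $$ where an empty sum is $0$. -/

import Mathlib

universe u

/-- The join `G₁ + G₂` of two vertex-disjoint graphs: their disjoint union together with all edges
between the two vertex sets. -/
def graphJoin {V W : Type*} (G : SimpleGraph V) (H : SimpleGraph W) : SimpleGraph (V ⊕ W) :=
  (G ⊕g H) ⊔ completeBipartiteGraph V W

/-- The graph `P₃ ∪ P₂`. -/
def graphP3P2 : SimpleGraph (Fin 3 ⊕ Fin 2) :=
  SimpleGraph.pathGraph 3 ⊕g SimpleGraph.pathGraph 2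

/-- The graph `(K₁ ∪ K₂) + K_p`. -/
def graphK1K2JoinK (p : ℕ) : SimpleGraph ((Fin 1 ⊕ Fin 2) ⊕ Fin p) :=
  graphJoin (SimpleGraph.completeGraph (Fin 1) ⊕g SimpleGraph.completeGraph (Fin 2)) (SimpleGraph.completeGraph (Fin p))

/-- `G` is `{P₃ ∪ P₂, (K₁ ∪ K₂) + K_p}`-free: neither graph is isomorphic to an induced subgraph
of `G`. -/
def IsP3P2K1K2JoinKFree {V : Type*} (p : ℕ) (G : SimpleGraph V) : Prop :=
  ¬ graphP3P2.IsIndContained G ∧ ¬ (graphK1K2JoinK p).IsIndContained G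

/-! Fix a largest clique `A`, `ω = |A|`, and sort the vertices by what they miss in `A`. Every
vertex misses something, and a vertex of `A` misses exactly itself. Vertices missing exactly one
vertex of `A` take the colour of that vertex (`colorableOn_missed_one`). Vertices missing two or
more hit fewer than `p` vertices of `A`, by the second forbidden graph. A set whose vertices all
miss two common vertices of `A` is `P₃`-free by the first forbidden graph, hence a disjoint union of
cliques.

The key gain is `colorableOn_missed_one_union`: a `P₃`-free set of vertices missing at least two
reuses the colours of `A` and costs only `p - 1` new ones. If `ω ≥ 3p - 1`, any three such vertices
miss two common vertices of `A`, so this finishes; `ω = 3p - 2` needs one extra `P₃`-free set. If `ω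
≤ p + 1`, the remaining vertices are split by the first two vertices of `A` they miss.

For intermediate `ω` there are two cases. If a clique of at least `p + 2` vertices misses two
vertices `i`, `j` of `A`, everything outside the common neighbourhood of `i` and `j` takes `2ω + 2`
colours, and that neighbourhood is handled by induction with `p - 2`. Otherwise all such cliques
have at most `p + 1` vertices, so vertices missing two vertices in one of a few segments of `A` are
cheap, and the segments are long enough to make the rest `P₃`-free. -/

/-! ### Forbidden subgraphs in terms of vertices -/

/-- `G` has no induced `P₃ ∪ P₂`, in terms of vertices. -/
def AvoidsP3P2 {V : Type*} (G : SimpleGraph V) : Prop :=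
  ∀ a b c d e : V, G.Adj a b → G.Adj b c → ¬ G.Adj a c → a ≠ c → G.Adj d e →
    ¬ G.Adj a d → ¬ G.Adj b d → ¬ G.Adj c d → ¬ G.Adj a e → ¬ G.Adj b e → ¬ G.Adj c e → False

/-- `G` has no induced `(K₁ ∪ K₂) + K_p`, in terms of vertices. -/
def AvoidsK1K2Join {V : Type*} (p : ℕ) (G : SimpleGraph V) : Prop :=
  ∀ (x y z : V) (K : Finset V), G.IsClique (K : Set V) → K.card = p →
    ¬ G.Adj x y → ¬ G.Adj x z → G.Adj y z →
    (∀ l ∈ K, G.Adj x l ∧ G.Adj y l ∧ G.Adj z l) → False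

/-- The vertices in `S` can be properly coloured with `n` colours. -/
def ColorableOn {V : Type*} (G : SimpleGraph V) (S : Set V) (n : ℕ) : Prop :=
  ∃ f : V → ℕ, (∀ x ∈ S, f x < n) ∧ ∀ x ∈ S, ∀ y ∈ S, G.Adj x y → f x ≠ f y

theorem avoidsP3P2_of_not_isIndContained {V : Type*} {G : SimpleGraph V}
    (h : ¬ graphP3P2.IsIndContained G) : AvoidsP3P2 G := by
  intro a b c d e hab hbc hac hne hde had hbd hcd hae hbe hce
  apply h
  have hab' := hab.ne
  have hbc' := hbc.ne
  have hde' := hde.ne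
  have h1 : a ≠ d := by rintro rfl; exact hbd hab.symm
  have h2 : b ≠ d := by rintro rfl; exact had hab
  have h3 : c ≠ d := by rintro rfl; exact hbd hbc
  have h4 : a ≠ e := by rintro rfl; exact hbe hab.symm
  have h5 : b ≠ e := by rintro rfl; exact hae hab
  have h6 : c ≠ e := by rintro rfl; exact hbe hbc
  have hca : ¬ G.Adj c a := fun h => hac h.symm
  have sym : ∀ {x y}, ¬ G.Adj x y → ¬ G.Adj y x := fun h h' => h h'.symm
  have key : ∀ u v, G.Adj (Sum.elim ![a, b, c] ![d, e] u) (Sum.elim ![a, b, c] ![d, e] v) ↔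
      graphP3P2.Adj u v := by
    rintro (i | i) (j | j) <;> fin_cases i <;> fin_cases j <;>
      simp [graphP3P2, SimpleGraph.pathGraph_adj, hab, hbc, hac, hde, had, hbd, hcd, hae, hbe, hce,
        hab.symm, hbc.symm, hca, hde.symm, sym had, sym hbd, sym hcd, sym hae, sym hbe, sym hce]
  refine ⟨⟨⟨Sum.elim ![a, b, c] ![d, e], ?_⟩, fun {u v} => key u v⟩⟩
  rintro (i | i) (j | j) hij <;> fin_cases i <;> fin_cases j <;> simp_all [eq_comm]

theorem avoidsK1K2Join_of_not_isIndContained {V : Type*} {G : SimpleGraph V} {p : ℕ}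
    (h : ¬ (graphK1K2JoinK p).IsIndContained G) : AvoidsK1K2Join p G := by
  intro x y z K hK hcard hxy hxz hyz hl
  apply h
  have e : Fin p ≃ K := (Fintype.equivFinOfCardEq (by simpa using hcard)).symm
  have hyz' := hyz.ne
  have hxy' : x ≠ y := by rintro rfl; exact hxz hyz
  have hxz' : x ≠ z := by rintro rfl; exact hxy hyz.symm
  have hx : ∀ i, G.Adj x (e i) := fun i => (hl _ (e i).2).1
  have hy : ∀ i, G.Adj y (e i) := fun i => (hl _ (e i).2).2.1
  have hz : ∀ i, G.Adj z (e i) := fun i => (hl _ (e i).2).2.2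
  have hK' : ∀ i j, G.Adj (e i) (e j) ↔ i ≠ j := by
    intro i j
    constructor
    · rintro h rfl; exact h.ne rfl
    · intro hij
      exact hK (e i).2 (e j).2 (fun h => hij (e.injective (Subtype.ext h)))
  have hyx : ¬ G.Adj y x := fun h => hxy h.symm
  have hzx : ¬ G.Adj z x := fun h => hxz h.symm
  have key : ∀ u v, G.Adj (Sum.elim (Sum.elim ![x] ![y, z]) (fun i => (e i : V)) u)
      (Sum.elim (Sum.elim ![x] ![y, z]) (fun i => (e i : V)) v) ↔ (graphK1K2JoinK p).Adj u v := by
    rintro ((i | i) | i) ((j | j) | j)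
    on_goal 9 => simp [graphK1K2JoinK, graphJoin, hK']
    all_goals (try fin_cases i) <;> (try fin_cases j) <;>
      simp [graphK1K2JoinK, graphJoin, hxy, hxz, hyz, hyx, hzx, hyz.symm, hx, hy, hz,
        (hx _).symm, (hy _).symm, (hz _).symm]
  refine ⟨⟨⟨Sum.elim (Sum.elim ![x] ![y, z]) (fun i => (e i : V)), ?_⟩, fun {u v} => key u v⟩⟩
  rintro ((i | i) | i) ((j | j) | j) hij
  on_goal 9 => simpa [Subtype.ext_iff] using hij
  all_goals (try fin_cases i) <;> (try fin_cases j) <;>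
    simp [hyz', hxy', hxz', hyz'.symm, hxy'.symm, hxz'.symm, (hx _).ne, (hy _).ne, (hz _).ne,
      (hx _).ne', (hy _).ne', (hz _).ne'] at hij ⊢

/-! ### Colouring sets of vertices -/

namespace ColorableOn

variable {V : Type*} {G : SimpleGraph V}

theorem mono {S T : Set V} {m n : ℕ} (h : ColorableOn G T n) (hST : S ⊆ T) (hmn : n ≤ m) :
    ColorableOn G S m := by
  obtain ⟨f, h1, h2⟩ := h
  exact ⟨f, fun x hx => (h1 x (hST hx)).trans_le hmn, fun x hx y hy => h2 x (hST hx) y (hST hy)⟩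

theorem union {S T : Set V} {m n : ℕ} (hS : ColorableOn G S m) (hT : ColorableOn G T n) :
    ColorableOn G (S ∪ T) (m + n) := by
  classical
  obtain ⟨f, h1, h2⟩ := hS
  obtain ⟨g, h3, h4⟩ := hT
  refine ⟨fun x => if x ∈ S then f x else m + g x, ?_, ?_⟩
  · rintro x hx
    by_cases hxS : x ∈ S
    · have := h1 x hxS
      simp only [hxS, if_true]; omega
    · have := h3 x (hx.resolve_left hxS)
      simp only [hxS, if_false]; omega
  · rintro x hx y hy hxy
    by_cases hxS : x ∈ S <;> by_cases hyS : y ∈ S <;> simp only [hxS, hyS, if_true, if_false]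
    · exact h2 x hxS y hyS hxy
    · have := h1 x hxS; omega
    · have := h1 y hyS; omega
    · have := h4 x (hx.resolve_left hxS) y (hy.resolve_left hyS) hxy; omega

theorem empty (n : ℕ) : ColorableOn G ∅ n := ⟨fun _ => 0, by simp, by simp⟩

theorem singleton (x : V) : ColorableOn G {x} 1 :=
  ⟨fun _ => 0, by simp, by rintro _ rfl _ rfl h; exact absurd rfl h.ne⟩

theorem iUnion {ι : Type*} (I : Finset ι) (S : ι → Set V) (c : ι → ℕ)
    (h : ∀ i ∈ I, ColorableOn G (S i) (c i)) :
    ColorableOn G {x | ∃ i ∈ I, x ∈ S i} (∑ i ∈ I, c i) := by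
  classical
  induction I using Finset.induction_on with
  | empty => simpa using empty (G := G) 0
  | insert a I ha ih =>
    rw [Finset.sum_insert ha]
    refine ((h a (by simp)).union (ih fun i hi => h i (by simp [hi]))).mono ?_ le_rfl
    rintro x ⟨i, hi, hx⟩
    rcases Finset.mem_insert.1 hi with rfl | hi
    · exact Or.inl hx
    · exact Or.inr ⟨i, hi, hx⟩

theorem colorable {n : ℕ} (h : ColorableOn G Set.univ n) : G.Colorable n := by
  obtain ⟨f, h1, h2⟩ := h
  exact ⟨SimpleGraph.Coloring.mk (fun x => ⟨f x, h1 x trivial⟩)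
    (fun {x y} hxy he => h2 x trivial y trivial hxy (by simpa using he))⟩

theorem of_induce {S : Set V} {n : ℕ} (h : (G.induce S).Colorable n) : ColorableOn G S n := by
  classical
  obtain ⟨C⟩ := h
  refine ⟨fun x => if hx : x ∈ S then C ⟨x, hx⟩ else 0, ?_, ?_⟩
  · intro x hx; simp [hx]
  · intro x hx y hy hxy he
    simp only [hx, hy, dif_pos] at he
    exact C.valid (v := ⟨x, hx⟩) (w := ⟨y, hy⟩) hxy (Fin.ext he)

end ColorableOn

/-! ### List colouring, disjoint unions of cliques, complete multipartite sets -/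

/-- Greedy list colouring. -/
theorem exists_list_coloring {V : Type*} [DecidableEq V] (G : SimpleGraph V) [DecidableRel G.Adj]
    (S : Finset V) (L : V → Finset ℕ) (h : ∀ x ∈ S, (S.filter (G.Adj x)).card < (L x).card) :
    ∃ f : V → ℕ, (∀ x ∈ S, f x ∈ L x) ∧ ∀ x ∈ S, ∀ y ∈ S, G.Adj x y → f x ≠ f y := by
  induction S using Finset.induction_on with
  | empty => exact ⟨fun _ => 0, by simp, by simp⟩
  | insert a S ha ih =>
    obtain ⟨f, h1, h2⟩ := ih fun x hx => lt_of_le_of_lt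
      (Finset.card_le_card (Finset.filter_subset_filter _ (Finset.subset_insert _ _)))
      (h x (by simp [hx]))
    obtain ⟨c, hc, hcn⟩ : ∃ c ∈ L a, c ∉ (S.filter (G.Adj a)).image f := by
      by_contra! hcon
      have h3 := Finset.card_le_card (fun c hc => hcon c hc : L a ⊆ (S.filter (G.Adj a)).image f)
      have h4 := h a (by simp)
      have h5 : (S.filter (G.Adj a)).card ≤ ((insert a S).filter (G.Adj a)).card :=
        Finset.card_le_card (Finset.filter_subset_filter _ (Finset.subset_insert _ _))
      have h6 : ((S.filter (G.Adj a)).image f).card ≤ _ := Finset.card_image_le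
      omega
    have hcn' : ∀ y ∈ S, G.Adj a y → f y ≠ c := by
      intro y hy hay he
      exact hcn (Finset.mem_image.2 ⟨y, by simp [hy, hay], he⟩)
    refine ⟨Function.update f a c, ?_, ?_⟩
    · intro x hx
      rcases Finset.mem_insert.1 hx with rfl | hx
      · simpa using hc
      · rw [Function.update_of_ne (fun e => ha (by rwa [← e]))]; exact h1 x hx
    · intro x hx y hy hxy
      rcases Finset.mem_insert.1 hx with rfl | hxS <;> rcases Finset.mem_insert.1 hy with rfl | hyS
      · exact absurd rfl hxy.ne
      · rw [Function.update_self, Function.update_of_ne (fun e => ha (by rwa [← e]))]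
        exact (hcn' y hyS hxy).symm
      · rw [Function.update_self, Function.update_of_ne (fun e => ha (by rwa [← e]))]
        exact hcn' x hxS hxy.symm
      · rw [Function.update_of_ne (fun e => ha (by rwa [← e])),
          Function.update_of_ne (fun e => ha (by rwa [← e]))]
        exact h2 x hxS y hyS hxy

/-- `S` induces a disjoint union of complete graphs. -/
def IsP3FreeOn {V : Type*} (G : SimpleGraph V) (S : Set V) : Prop :=
  ∀ a ∈ S, ∀ b ∈ S, ∀ c ∈ S, G.Adj a b → G.Adj b c → a ≠ c → G.Adj a c

/-- In a disjoint union of cliques a closed neighbourhood is a clique; this is the degree bound that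
greedy colouring needs. -/
theorem IsP3FreeOn.card_filter_lt {V : Type*} [DecidableEq V] {G : SimpleGraph V}
    [DecidableRel G.Adj] {S : Finset V} {n : ℕ} (hS : IsP3FreeOn G S)
    (hn : ∀ T ⊆ S, G.IsClique (T : Set V) → T.card ≤ n) {x : V} (hx : x ∈ S) :
    (S.filter (G.Adj x)).card < n := by
  have h := hn (insert x (S.filter (G.Adj x))) (by
      intro y hy
      rcases Finset.mem_insert.1 hy with rfl | hy
      · exact hx
      · exact (Finset.mem_filter.1 hy).1) (by
    rw [Finset.coe_insert, SimpleGraph.isClique_insert]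
    refine ⟨?_, fun y hy _ => (Finset.mem_filter.1 hy).2⟩
    intro y hy z hz hyz
    have hy := Finset.mem_filter.1 hy
    have hz := Finset.mem_filter.1 hz
    exact hS y hy.1 x hx z hz.1 hy.2.symm hz.2 hyz)
  rw [Finset.card_insert_of_notMem (by simp)] at h
  exact h

theorem IsP3FreeOn.colorableOn {V : Type*} [Finite V] {G : SimpleGraph V} {S : Set V} {n : ℕ}
    (hS : IsP3FreeOn G S)
    (hn : ∀ T : Finset V, (T : Set V) ⊆ S → G.IsClique (T : Set V) → T.card ≤ n) :
    ColorableOn G S n := by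
  classical
  have := Fintype.ofFinite V
  obtain ⟨f, h1, h2⟩ := exists_list_coloring G S.toFinset (fun _ => Finset.range n) (by
    intro x hx
    rw [Finset.card_range]
    exact IsP3FreeOn.card_filter_lt (by simpa using hS)
      (fun T hT hc => hn T (fun y hy => by simpa using hT hy) hc) hx)
  exact ⟨f, fun x hx => by simpa using h1 x (by simpa using hx),
    fun x hx y hy => h2 x (by simpa using hx) y (by simpa using hy)⟩

/-- A set on which nonadjacency is transitive is coloured with as many colours as its largest
clique has vertices. -/
theorem ColorableOn.of_trans_not_adj {V : Type*} {G : SimpleGraph V} {S : Set V} {n : ℕ}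
    (hS : ∀ a ∈ S, ∀ b ∈ S, ∀ c ∈ S, ¬ G.Adj a b → ¬ G.Adj b c → ¬ G.Adj a c)
    (hn : ∀ T : Finset V, (T : Set V) ⊆ S → G.IsClique (T : Set V) → T.card ≤ n) :
    ColorableOn G S n := by
  apply ColorableOn.of_induce
  have h1 : (G.induce S).IsCompleteMultipartite :=
    ⟨fun a b c hab hbc => hS a a.2 b b.2 c c.2 hab hbc⟩
  have h2 : (G.induce S).CliqueFree (n + 1) := by
    intro T hT
    have h3 := hn (T.map (Function.Embedding.subtype _)) (by
      intro x hx
      simp only [Finset.coe_map, Set.mem_image] at hx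
      obtain ⟨y, -, rfl⟩ := hx
      exact y.2) (by
      intro x hx y hy hxy
      simp only [Finset.coe_map, Set.mem_image] at hx hy
      obtain ⟨x, hx, rfl⟩ := hx
      obtain ⟨y, hy, rfl⟩ := hy
      exact hT.1 hx hy (fun h => hxy (by rw [h])))
    rw [Finset.card_map, hT.2] at h3
    omega
  exact h1.colorable_of_cliqueFree h2

/-! ### Vertices relative to a largest clique -/

open Classical in
/-- The vertices of `A` that are not adjacent to `x`. -/
noncomputable def missed {V : Type*} (G : SimpleGraph V) (A : Finset V) (x : V) : Finset V :=
  A.filter fun v => ¬ G.Adj x v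

open Classical in
/-- The vertices of `A` that are adjacent to `x`. -/
noncomputable def hit {V : Type*} (G : SimpleGraph V) (A : Finset V) (x : V) : Finset V :=
  A.filter fun v => G.Adj x v

open Classical in
/-- The vertices `a` of `A` such that `x` is adjacent to a vertex that misses only `a` in `A`. -/
noncomputable def touched {V : Type*} (G : SimpleGraph V) (A : Finset V) (x : V) : Finset V :=
  A.filter fun a => ∃ y, missed G A y = {a} ∧ G.Adj x y

/-- `A` is a clique of `G` with the largest number of vertices. -/
structure IsLargestClique {V : Type*} (G : SimpleGraph V) (A : Finset V) : Prop where
  isClique : G.IsClique (A : Set V)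
  card_le : ∀ K : Finset V, G.IsClique (K : Set V) → K.card ≤ A.card

section

variable {V : Type*} {G : SimpleGraph V} {A : Finset V} {p : ℕ}

theorem mem_missed {x v : V} : v ∈ missed G A x ↔ v ∈ A ∧ ¬ G.Adj x v := by
  classical
  simp [missed]

theorem mem_hit {x v : V} : v ∈ hit G A x ↔ v ∈ A ∧ G.Adj x v := by
  classical
  simp [hit]

theorem mem_touched {x a : V} :
    a ∈ touched G A x ↔ a ∈ A ∧ ∃ y, missed G A y = {a} ∧ G.Adj x y := by
  classical
  simp [touched]

theorem card_hit_add_card_missed (x : V) : (hit G A x).card + (missed G A x).card = A.card := by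
  classical
  exact Finset.card_filter_add_card_filter_not _

theorem adj_of_missed_eq_singleton {x a v : V} (h : missed G A x = {a}) (hv : v ∈ A)
    (hva : v ≠ a) : G.Adj x v := by
  by_contra hcon
  have : v ∈ missed G A x := mem_missed.2 ⟨hv, hcon⟩
  rw [h] at this
  exact hva (by simpa using this)

theorem exists_index (A : Finset V) :
    ∃ f : V → ℕ, (∀ a ∈ A, f a < A.card) ∧ Set.InjOn f (A : Set V) := by
  classical
  refine ⟨fun a => if h : a ∈ A then A.equivFin ⟨a, h⟩ else 0, ?_, ?_⟩
  · intro a ha; simp [ha]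
  · intro a ha b hb hab
    have ha' : a ∈ A := ha
    have hb' : b ∈ A := hb
    simp only [ha', hb', dif_pos] at hab
    simpa using A.equivFin.injective (Fin.ext hab)

namespace IsLargestClique

theorem missed_nonempty (hA : IsLargestClique G A) (x : V) : (missed G A x).Nonempty := by
  classical
  by_contra h
  rw [Finset.not_nonempty_iff_eq_empty] at h
  have hx : ∀ v ∈ A, G.Adj x v := by
    intro v hv
    by_contra hcon
    have : v ∈ missed G A x := mem_missed.2 ⟨hv, hcon⟩
    simp [h] at this
  have hxA : x ∉ A := fun hxA => (hx x hxA).ne rfl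
  have := hA.card_le (insert x A) (by
    rw [Finset.coe_insert, SimpleGraph.isClique_insert]
    exact ⟨hA.isClique, fun v hv _ => hx v hv⟩)
  rw [Finset.card_insert_of_notMem hxA] at this
  omega

/-- Otherwise exchanging `a` for `x` and `y` would enlarge `A`. -/
theorem not_adj_of_missed_eq (hA : IsLargestClique G A)
    {x y a : V} (hx : missed G A x = {a}) (hy : missed G A y = {a}) :
    ¬ G.Adj x y := by
  classical
  intro hxy
  have haA : a ∈ A := (mem_missed.1 (by rw [hx]; simp : a ∈ missed G A x)).1
  have hxa : ¬ G.Adj x a := (mem_missed.1 (by rw [hx]; simp : a ∈ missed G A x)).2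
  have hya : ¬ G.Adj y a := (mem_missed.1 (by rw [hy]; simp : a ∈ missed G A y)).2
  have hx' : ∀ v ∈ A.erase a, G.Adj x v := fun v hv =>
    adj_of_missed_eq_singleton hx (Finset.mem_of_mem_erase hv) (Finset.ne_of_mem_erase hv)
  have hy' : ∀ v ∈ A.erase a, G.Adj y v := fun v hv =>
    adj_of_missed_eq_singleton hy (Finset.mem_of_mem_erase hv) (Finset.ne_of_mem_erase hv)
  have hxn : x ∉ A.erase a := fun h => (hx' x h).ne rfl
  have hyn : y ∉ A.erase a := fun h => (hy' y h).ne rfl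
  have := hA.card_le (insert x (insert y (A.erase a))) (by
    rw [Finset.coe_insert, SimpleGraph.isClique_insert, Finset.coe_insert,
      SimpleGraph.isClique_insert]
    refine ⟨⟨hA.isClique.subset (by simp), fun v hv _ => hy' v (Finset.mem_coe.1 hv)⟩, ?_⟩
    intro v hv _
    rcases hv with rfl | hv
    · exact hxy
    · exact hx' v (Finset.mem_coe.1 hv))
  rw [Finset.card_insert_of_notMem (by simpa [hxy.ne] using hxn),
    Finset.card_insert_of_notMem hyn, Finset.card_erase_of_mem haA] at this
  have := Finset.card_pos.2 ⟨a, haA⟩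
  omega

/-- If `x` and `y` were nonadjacent, `y` and the edge `xb` would form `K₁ ∪ K₂`, joined to `p`
vertices of `A` other than `a` and `b`. -/
theorem adj_of_missed_ne (hA : IsLargestClique G A)
    (hK : AvoidsK1K2Join p G) (hp : p + 2 ≤ A.card) {x y a b : V}
    (hx : missed G A x = {a}) (hy : missed G A y = {b}) (hab : a ≠ b) : G.Adj x y := by
  classical
  by_contra hxy
  have hbA : b ∈ A := (mem_missed.1 (by rw [hy]; simp : b ∈ missed G A y)).1
  have hyb : ¬ G.Adj y b := (mem_missed.1 (by rw [hy]; simp : b ∈ missed G A y)).2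
  have hcard : p ≤ ((A.erase a).erase b).card := by
    have h1 := Finset.pred_card_le_card_erase (s := A) (a := a)
    have h2 := Finset.pred_card_le_card_erase (s := A.erase a) (a := b)
    omega
  obtain ⟨K, hKs, hKc⟩ := Finset.exists_subset_card_eq hcard
  have hKA : ∀ l ∈ K, l ∈ A ∧ l ≠ a ∧ l ≠ b := by
    intro l hl
    have := hKs hl
    simp only [Finset.mem_erase] at this
    tauto
  refine hK y x b K (hA.isClique.subset fun l hl => (hKA l hl).1) hKc (fun h => hxy h.symm) hyb
    (adj_of_missed_eq_singleton hx hbA hab.symm) fun l hl => ?_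
  obtain ⟨h1, h2, h3⟩ := hKA l hl
  exact ⟨adj_of_missed_eq_singleton hy h1 h3, adj_of_missed_eq_singleton hx h1 h2,
    hA.isClique hbA h1 h3.symm⟩

/-- Two missed vertices form an edge which, with `x`, is joined to every hit vertex. -/
theorem card_hit_lt (hA : IsLargestClique G A)
    (hK : AvoidsK1K2Join p G) {x : V} (hx : 2 ≤ (missed G A x).card) :
    (hit G A x).card < p := by
  classical
  by_contra! hcon
  obtain ⟨K, hKs, hKc⟩ := Finset.exists_subset_card_eq hcon
  obtain ⟨v, hv, w, hw, hvw⟩ := Finset.one_lt_card.1 hx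
  rw [mem_missed] at hv hw
  refine hK x v w K (hA.isClique.subset fun l hl => (mem_hit.1 (hKs hl)).1) hKc hv.2 hw.2
    (hA.isClique hv.1 hw.1 hvw) fun l hl => ?_
  have h := mem_hit.1 (hKs hl)
  refine ⟨h.2, hA.isClique hv.1 h.1 ?_, hA.isClique hw.1 h.1 ?_⟩
  · rintro rfl; exact hv.2 h.2
  · rintro rfl; exact hw.2 h.2

/-- Each `a` in `A` is itself a vertex that misses only `a`. -/
theorem hit_subset_touched (hA : IsLargestClique G A) (x : V) : hit G A x ⊆ touched G A x := by
  intro a ha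
  rw [mem_hit] at ha
  refine mem_touched.2 ⟨ha.1, a, ?_, ha.2⟩
  ext v
  rw [mem_missed, Finset.mem_singleton]
  constructor
  · rintro ⟨hv, hav⟩
    by_contra hne
    exact hav (hA.isClique ha.1 hv (Ne.symm hne))
  · rintro rfl
    exact ⟨ha.1, fun h => h.ne rfl⟩

/-- Bounds the colours of `A` forbidden to `x`. If `p` vertices were touched, their witnesses would
form a `p`-clique by `adj_of_missed_ne`, joined to `x` and to an edge of `A` that `x` misses. -/
theorem card_touched_lt (hA : IsLargestClique G A)
    (hK : AvoidsK1K2Join p G) (hp : p + 2 ≤ A.card) {x : V}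
    (hx : 2 ≤ (missed G A x).card) : (touched G A x).card < p := by
  classical
  by_contra! hcon
  -- `P` contains all hit vertices, so anything in `A` outside `P` is missed by `x`.
  obtain ⟨P, hP1, hP2, hPc⟩ := Finset.exists_subsuperset_card_eq (hA.hit_subset_touched x)
    (hA.card_hit_lt hK hx).le hcon
  have hPA : P ⊆ A := fun a ha => (mem_touched.1 (hP2 ha)).1
  have h2 : 2 ≤ (A \ P).card := by rw [Finset.card_sdiff_of_subset hPA]; omega
  obtain ⟨v, hv, w, hw, hvw⟩ := Finset.one_lt_card.1 h2
  rw [Finset.mem_sdiff] at hv hw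
  have hxv : ¬ G.Adj x v := fun h => hv.2 (hP1 (mem_hit.2 ⟨hv.1, h⟩))
  have hxw : ¬ G.Adj x w := fun h => hw.2 (hP1 (mem_hit.2 ⟨hw.1, h⟩))
  choose! y hy using fun a (ha : a ∈ P) => (mem_touched.1 (hP2 ha)).2
  have hyadj : ∀ a ∈ P, ∀ b ∈ P, a ≠ b → G.Adj (y a) (y b) := fun a ha b hb hab =>
    hA.adj_of_missed_ne hK hp (hy a ha).1 (hy b hb).1 hab
  refine hK x v w (P.image y) ?_ ?_ hxv hxw (hA.isClique hv.1 hw.1 hvw) ?_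
  · intro s hs t ht hst
    simp only [Finset.coe_image, Set.mem_image, Finset.mem_coe] at hs ht
    obtain ⟨a, ha, rfl⟩ := hs
    obtain ⟨b, hb, rfl⟩ := ht
    exact hyadj a ha b hb (fun h => hst (by rw [h]))
  · rw [Finset.card_image_of_injOn, hPc]
    intro a ha b hb hab
    by_contra hne
    exact (hyadj a ha b hb hne).ne hab
  · intro l hl
    obtain ⟨a, ha, rfl⟩ := Finset.mem_image.1 hl
    refine ⟨(hy a ha).2, ?_, ?_⟩
    · exact (adj_of_missed_eq_singleton (hy a ha).1 hv.1 (fun h => hv.2 (h ▸ ha))).symm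
    · exact (adj_of_missed_eq_singleton (hy a ha).1 hw.1 (fun h => hw.2 (h ▸ ha))).symm

theorem isP3FreeOn (hA : IsLargestClique G A) (h : AvoidsP3P2 G) {D : Set V}
    (hD : ∀ a ∈ D, ∀ b ∈ D, ∀ c ∈ D, ∃ v ∈ A, ∃ w ∈ A, v ≠ w ∧
      ∀ x, x = a ∨ x = b ∨ x = c → ¬ G.Adj x v ∧ ¬ G.Adj x w) : IsP3FreeOn G D := by
  intro a ha b hb c hc hab hbc hac
  by_contra hcon
  obtain ⟨v, hv, w, hw, hvw, h3⟩ := hD a ha b hb c hc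
  have h4 := h3 a (by simp)
  have h5 := h3 b (by simp)
  have h6 := h3 c (by simp)
  exact h a b c v w hab hbc hcon hac (hA.isClique hv hw hvw) h4.1 h5.1 h6.1 h4.2 h5.2 h6.2

theorem isP3FreeOn_of_card_hit (hA : IsLargestClique G A)
    [DecidableEq V] (h : AvoidsP3P2 G) {D : Set V}
    (hD : ∀ a ∈ D, ∀ b ∈ D, ∀ c ∈ D,
      (hit G A a ∪ hit G A b ∪ hit G A c).card + 2 ≤ A.card) : IsP3FreeOn G D := by
  refine hA.isP3FreeOn h fun a ha b hb c hc => ?_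
  have h1 := Finset.le_card_sdiff (hit G A a ∪ hit G A b ∪ hit G A c) A
  have h2 := hD a ha b hb c hc
  obtain ⟨v, hv, w, hw, hvw⟩ := Finset.one_lt_card.1
    (show 2 ≤ (A \ (hit G A a ∪ hit G A b ∪ hit G A c)).card by omega)
  simp only [Finset.mem_sdiff, Finset.mem_union, mem_hit, not_or, not_and] at hv hw
  refine ⟨v, hv.1, w, hw.1, hvw, ?_⟩
  rintro x (rfl | rfl | rfl)
  · exact ⟨hv.2.1.1 hv.1, hw.2.1.1 hw.1⟩
  · exact ⟨hv.2.1.2 hv.1, hw.2.1.2 hw.1⟩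
  · exact ⟨hv.2.2 hv.1, hw.2.2 hw.1⟩

theorem isP3FreeOn_both_missed (hA : IsLargestClique G A)
    (h : AvoidsP3P2 G) {i j : V} (hi : i ∈ A) (hj : j ∈ A)
    (hij : i ≠ j) : IsP3FreeOn G {x | ¬ G.Adj x i ∧ ¬ G.Adj x j} := by
  refine hA.isP3FreeOn h fun a ha b hb c hc => ⟨i, hi, j, hj, hij, ?_⟩
  rintro x (rfl | rfl | rfl) <;> assumption

theorem colorableOn_both_missed (hA : IsLargestClique G A)
    [Finite V] (h : AvoidsP3P2 G) {i j : V} (hi : i ∈ A) (hj : j ∈ A)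
    (hij : i ≠ j) {S : Set V} (hS : ∀ x ∈ S, ¬ G.Adj x i ∧ ¬ G.Adj x j) {n : ℕ}
    (hn : ∀ T : Finset V, (T : Set V) ⊆ S → G.IsClique (T : Set V) → T.card ≤ n) :
    ColorableOn G S n :=
  IsP3FreeOn.colorableOn (fun a ha b hb c hc =>
    hA.isP3FreeOn_both_missed h hi hj hij a (hS a ha) b (hS b hb) c (hS c hc)) hn

theorem colorableOn_missed_one (hA : IsLargestClique G A) :
    ColorableOn G {x | (missed G A x).card = 1} A.card := by
  classical
  obtain ⟨f, hf1, hf2⟩ := exists_index A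
  have hm : ∀ x : V, ∃ a, a ∈ missed G A x := fun x => hA.missed_nonempty x
  choose m hm using hm
  have hm' : ∀ x, (missed G A x).card = 1 → missed G A x = {m x} := by
    intro x hx
    obtain ⟨a, ha⟩ := Finset.card_eq_one.1 hx
    have := hm x
    rw [ha] at this ⊢
    rw [Finset.mem_singleton.1 this]
  refine ⟨fun x => f (m x), fun x _ => hf1 _ (mem_missed.1 (hm x)).1, ?_⟩
  intro x hx y hy hxy he
  have hxy' := hf2 (mem_missed.1 (hm x)).1 (mem_missed.1 (hm y)).1 he
  exact hA.not_adj_of_missed_eq (hm' x hx) (hxy' ▸ hm' y hy) hxy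

/-- The vertices that miss one vertex of the clique get the colour of that vertex, and a `P₃`-free
set of further vertices needs only `p - 1` more colours. -/
theorem colorableOn_missed_one_union (hA : IsLargestClique G A)
    [Finite V] (hK : AvoidsK1K2Join p G) (hp : p + 2 ≤ A.card)
    {D : Set V} (hD2 : ∀ x ∈ D, 2 ≤ (missed G A x).card) (hD : IsP3FreeOn G D) :
    ColorableOn G ({x | (missed G A x).card = 1} ∪ D) (A.card + (p - 1)) := by
  classical
  have := Fintype.ofFinite V
  obtain ⟨f, hf1, hf2⟩ := exists_index A
  have hm : ∀ x : V, ∃ a, a ∈ missed G A x := fun x => hA.missed_nonempty x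
  choose m hm using hm
  have hm' : ∀ x, (missed G A x).card = 1 → missed G A x = {m x} := by
    intro x hx
    obtain ⟨a, ha⟩ := Finset.card_eq_one.1 hx
    have := hm x
    rw [ha] at this ⊢
    rw [Finset.mem_singleton.1 this]
  have hmA : ∀ x, m x ∈ A := fun x => (mem_missed.1 (hm x)).1
  -- The allowed colours are those of untouched vertices of `A` and `p - 1` new ones. Fewer than `p`
  -- are touched, so at least `ω` remain, more than the degree within `D`.
  let L : V → Finset ℕ := fun x =>
    ((A \ touched G A x).image f) ∪ Finset.Ico A.card (A.card + (p - 1))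
  have hL : ∀ x ∈ D, A.card ≤ (L x).card := by
    intro x hx
    have h1 := hA.card_touched_lt hK hp (hD2 x hx)
    have h2 : touched G A x ⊆ A := fun a ha => (mem_touched.1 ha).1
    have h3 := Finset.card_le_card h2
    have hdisj : Disjoint ((A \ touched G A x).image f)
        (Finset.Ico A.card (A.card + (p - 1))) := by
      rw [Finset.disjoint_left]
      intro c hc hc'
      obtain ⟨a, ha, rfl⟩ := Finset.mem_image.1 hc
      have := hf1 a (Finset.mem_sdiff.1 ha).1
      have := (Finset.mem_Ico.1 hc').1
      omega
    rw [Finset.card_union_of_disjoint hdisj, Finset.card_image_of_injOn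
      (hf2.mono (by intro a ha; exact (Finset.mem_sdiff.1 ha).1)),
      Finset.card_sdiff_of_subset h2, Nat.card_Ico]
    omega
  obtain ⟨g, hg1, hg2⟩ := exists_list_coloring G D.toFinset L (by
    intro x hx
    refine lt_of_lt_of_le ?_ (hL x (by simpa using hx))
    exact IsP3FreeOn.card_filter_lt (by simpa using hD) (fun T _ hc => hA.card_le T hc) hx)
  have hJD : ∀ x, (missed G A x).card = 1 → x ∉ D := by
    intro x hx hxD
    have := hD2 x hxD
    omega
  have hcross : ∀ x ∈ D, ∀ y, (missed G A y).card = 1 → G.Adj x y → g x ≠ f (m y) := by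
    intro x hx y hy hxy he
    have h1 := hg1 x (by simpa using hx)
    rcases Finset.mem_union.1 h1 with h1 | h1
    · obtain ⟨a, ha, hae⟩ := Finset.mem_image.1 h1
      rw [Finset.mem_sdiff] at ha
      have := hf2 ha.1 (hmA y) (hae.trans he)
      subst this
      exact ha.2 (mem_touched.2 ⟨ha.1, y, hm' y hy, hxy⟩)
    · have := (Finset.mem_Ico.1 h1).1
      have := hf1 _ (hmA y)
      omega
  refine ⟨fun x => if x ∈ D then g x else f (m x), ?_, ?_⟩
  · rintro x hx
    by_cases hxD : x ∈ D
    · simp only [hxD, if_true]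
      rcases Finset.mem_union.1 (hg1 x (by simpa using hxD)) with h1 | h1
      · obtain ⟨a, ha, hae⟩ := Finset.mem_image.1 h1
        have := hf1 a (Finset.mem_sdiff.1 ha).1
        omega
      · exact (Finset.mem_Ico.1 h1).2
    · simp only [hxD, if_false]
      exact (hf1 _ (hmA x)).trans_le (by omega)
  · rintro x hx y hy hxy
    by_cases hxD : x ∈ D <;> by_cases hyD : y ∈ D <;> simp only [hxD, hyD, if_true, if_false]
    · exact hg2 x (by simpa using hxD) y (by simpa using hyD) hxy
    · exact hcross x hxD y (hy.resolve_right hyD) hxy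
    · exact (hcross y hyD x (hx.resolve_right hxD) hxy.symm).symm
    · intro he
      have hxy' := hf2 (hmA x) (hmA y) he
      exact hA.not_adj_of_missed_eq (hm' x (hx.resolve_right hxD))
        (hxy' ▸ hm' y (hy.resolve_right hyD)) hxy

end IsLargestClique

end

/-! ### Pairs of missed vertices, and the extreme clique sizes -/

section

variable {V : Type*} {G : SimpleGraph V} {A : Finset V} {p : ℕ}

/-- The vertices nonadjacent to at least two of `v 0, …, v (b - 1)`. -/
def missesTwo (G : SimpleGraph V) (v : ℕ → V) (b : ℕ) : Set V :=
  {x | ∃ j < b, ∃ i < j, ¬ G.Adj x (v i) ∧ ¬ G.Adj x (v j)}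

/-- Sort by the first two missed indices `i < j`: each `j` leaves `j` choices of `i`. -/
theorem colorableOn_missesTwo (v : ℕ → V) (b : ℕ) (c : ℕ → ℕ)
    (h : ∀ j < b, ∀ i < j, ColorableOn G
      {x | ¬ G.Adj x (v i) ∧ ¬ G.Adj x (v j) ∧ ∀ l < j, l ≠ i → G.Adj x (v l)} (c j)) :
    ColorableOn G (missesTwo G v b) (∑ j ∈ Finset.range b, j * c j) := by
  induction b with
  | zero => exact (ColorableOn.empty _).mono (by rintro x ⟨j, hj, -⟩; omega) le_rfl
  | succ b ih =>
    have h1 := ih fun j hj => h j (by omega)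
    have h2 := ColorableOn.iUnion (G := G) (Finset.range b)
      (fun i => {x | ¬ G.Adj x (v i) ∧ ¬ G.Adj x (v b) ∧ ∀ l < b, l ≠ i → G.Adj x (v l)})
      (fun _ => c b) (fun i hi => h b (by omega) i (Finset.mem_range.1 hi))
    rw [Finset.sum_const, Finset.card_range, smul_eq_mul] at h2
    rw [Finset.sum_range_succ]
    refine (h1.union h2).mono ?_ le_rfl
    rintro x ⟨j, hj, i, hij, hxi, hxj⟩
    by_cases hx : x ∈ missesTwo G v b
    · exact Or.inl hx
    · right
      obtain rfl : j = b := by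
        by_contra hne
        exact hx ⟨j, by omega, i, hij, hxi, hxj⟩
      refine ⟨i, Finset.mem_range.2 hij, hxi, hxj, fun l hl hli => ?_⟩
      by_contra hxl
      rcases lt_or_gt_of_ne hli with h3 | h3
      · exact hx ⟨i, hij, l, h3, hxl, hxi⟩
      · exact hx ⟨l, hl, i, h3, hxi, hxl⟩

theorem card_missed_inter_le_one [DecidableEq V] {v : ℕ → V} {b : ℕ} {x : V}
    (hx : x ∉ missesTwo G v b) :
    (missed G A x ∩ (Finset.range b).image v).card ≤ 1 := by
  rw [Finset.card_le_one]
  intro y hy z hz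
  by_contra hne
  simp only [Finset.mem_inter, mem_missed, Finset.mem_image, Finset.mem_range] at hy hz
  obtain ⟨⟨-, hxy⟩, i, hi, rfl⟩ := hy
  obtain ⟨⟨-, hxz⟩, j, hj, rfl⟩ := hz
  rcases lt_trichotomy i j with h | rfl | h
  · exact hx ⟨j, hj, i, h, hxy, hxz⟩
  · exact hne rfl
  · exact hx ⟨i, hi, j, h, hxz, hxy⟩

theorem exists_enumeration [Nonempty V] (A : Finset V) :
    ∃ v : ℕ → V, (∀ i < A.card, v i ∈ A) ∧ Set.InjOn v (Set.Iio A.card) ∧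
      ∀ a ∈ A, ∃ i < A.card, v i = a := by
  classical
  refine ⟨fun i => if h : i < A.card then A.equivFin.symm ⟨i, h⟩ else Classical.arbitrary V,
    ?_, ?_, ?_⟩
  · intro i hi; simp [hi]
  · intro i hi j hj hij
    have hi' : i < A.card := hi
    have hj' : j < A.card := hj
    simp only [hi', hj', dif_pos] at hij
    simpa using A.equivFin.symm.injective (Subtype.ext hij)
  · intro a ha
    refine ⟨A.equivFin ⟨a, ha⟩, (A.equivFin ⟨a, ha⟩).2, ?_⟩
    simp

namespace IsLargestClique

/-- `T` together with the `j - 1` vertices `v l`, `l < j`, `l ≠ i`, is a clique. -/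
theorem card_add_le (hA : IsLargestClique G A) {v : ℕ → V} {i j : ℕ} (hij : i < j)
    (hv : ∀ l < j, v l ∈ A) (hinj : Set.InjOn v (Set.Iio j)) {T : Finset V}
    (hT : G.IsClique (T : Set V)) (hTi : ∀ x ∈ T, ¬ G.Adj x (v i))
    (hTl : ∀ x ∈ T, ∀ l < j, l ≠ i → G.Adj x (v l)) : T.card + (j - 1) ≤ A.card := by
  classical
  have hL : ∀ y ∈ ((Finset.range j).erase i).image v, ∃ l < j, l ≠ i ∧ v l = y := by
    intro y hy
    obtain ⟨l, hl, rfl⟩ := Finset.mem_image.1 hy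
    rw [Finset.mem_erase, Finset.mem_range] at hl
    exact ⟨l, hl.2, hl.1, rfl⟩
  have hdisj : Disjoint T (((Finset.range j).erase i).image v) := by
    rw [Finset.disjoint_left]
    intro x hx hx'
    obtain ⟨l, hl, hli, rfl⟩ := hL x hx'
    exact hTi _ hx (hA.isClique (hv l hl) (hv i hij) fun h => hli (hinj hl hij h))
  have hcard : (((Finset.range j).erase i).image v).card = j - 1 := by
    rw [Finset.card_image_of_injOn, Finset.card_erase_of_mem (Finset.mem_range.2 hij),
      Finset.card_range]
    refine hinj.mono fun l hl => ?_
    simp only [Finset.coe_erase, Finset.coe_range, Set.mem_sdiff] at hl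
    exact hl.1
  rw [← hcard, ← Finset.card_union_of_disjoint hdisj]
  refine hA.card_le _ ?_
  intro x hx y hy hxy
  rw [Finset.coe_union] at hx hy
  rcases hx with hx | hx <;> rcases hy with hy | hy
  · exact hT hx hy hxy
  · obtain ⟨l, hl, hli, rfl⟩ := hL y hy
    exact hTl x hx l hl hli
  · obtain ⟨l, hl, hli, rfl⟩ := hL x hx
    exact (hTl y hy l hl hli).symm
  · obtain ⟨l, hl, hli, rfl⟩ := hL x hx
    obtain ⟨l', hl', hli', rfl⟩ := hL y hy
    exact hA.isClique (hv l hl) (hv l' hl') hxy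

/-- If every clique missing two given vertices of `A` has at most `m` vertices, then the vertices
missing two of `v 0, …, v (b - 1)` are coloured by their first two missed vertices. -/
theorem colorableOn_missesTwo [Finite V] (hA : IsLargestClique G A) (h : AvoidsP3P2 G)
    {v : ℕ → V} {b m : ℕ} (hv : ∀ l < b, v l ∈ A) (hinj : Set.InjOn v (Set.Iio b))
    (hm : ∀ i ∈ A, ∀ j ∈ A, i ≠ j → ∀ T : Finset V, G.IsClique (T : Set V) →
      (∀ x ∈ T, ¬ G.Adj x i ∧ ¬ G.Adj x j) → T.card ≤ m) :
    ColorableOn G (missesTwo G v b) (∑ j ∈ Finset.range b, j * min m (A.card + 1 - j)) := by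
  refine _root_.colorableOn_missesTwo v b _ fun j hj i hij => ?_
  have hij' : v i ≠ v j := fun he => hij.ne (hinj (hij.trans hj) hj he)
  refine hA.colorableOn_both_missed h (hv i (by omega)) (hv j hj) hij'
    (fun x hx => ⟨hx.1, hx.2.1⟩) fun T hT hTc => ?_
  have h1 := hm _ (hv i (by omega)) _ (hv j hj) hij' T hTc fun x hx => ⟨(hT hx).1, (hT hx).2.1⟩
  have h2 := hA.card_add_le hij (fun l hl => hv l (by omega))
    (hinj.mono (Set.Iio_subset_Iio hj.le)) hTc (fun x hx => (hT hx).1) fun x hx => (hT hx).2.2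
  omega

/-- A `P₃`-free set in which each vertex misses few vertices of a fixed part `S` of the clique. -/
theorem isP3FreeOn_of_card_missed_inter [DecidableEq V] (hA : IsLargestClique G A)
    (h : AvoidsP3P2 G) (hK : AvoidsK1K2Join p G) {S : Finset V} (hS : S ⊆ A) {e : ℕ}
    (hcard : 3 * p + 3 * e ≤ A.card + 2 * S.card + 1) {D : Set V}
    (hD2 : ∀ x ∈ D, 2 ≤ (missed G A x).card) (hDe : ∀ x ∈ D, (missed G A x ∩ S).card ≤ e) :
    IsP3FreeOn G D := by
  -- At most `p - 1` vertices are hit and at least `|S| - e` of them lie in `S`. Three hit sets thus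
  -- cover at most `|S| + 3(p - 1 + e - |S|)` vertices, which `hcard` keeps at most `|A| - 2`.
  have key : ∀ x ∈ D, (hit G A x \ S).card + S.card + 1 ≤ p + e := by
    intro x hx
    have h1 := hA.card_hit_lt hK (hD2 x hx)
    have h2 := Finset.card_sdiff_add_card_inter (hit G A x) S
    have h3 : S = (hit G A x ∩ S) ∪ (missed G A x ∩ S) := by
      ext y
      simp only [Finset.mem_union, Finset.mem_inter, mem_hit, mem_missed]
      have := @hS y
      tauto
    have h4 := Finset.card_union_le (hit G A x ∩ S) (missed G A x ∩ S)
    rw [← h3] at h4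
    have h5 := hDe x hx
    omega
  refine hA.isP3FreeOn_of_card_hit h fun a ha b hb c hc => ?_
  have h1 : hit G A a ∪ hit G A b ∪ hit G A c ⊆
      S ∪ (hit G A a \ S ∪ hit G A b \ S ∪ hit G A c \ S) := by
    intro y hy
    simp only [Finset.mem_union, Finset.mem_sdiff] at hy ⊢
    tauto
  have h2 := Finset.card_le_card h1
  have h3 := Finset.card_union_le S (hit G A a \ S ∪ hit G A b \ S ∪ hit G A c \ S)
  have h4 := Finset.card_union_le (hit G A a \ S ∪ hit G A b \ S) (hit G A c \ S)
  have h5 := Finset.card_union_le (hit G A a \ S) (hit G A b \ S)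
  have h6 := key a ha
  have h7 := key b hb
  have h8 := key c hc
  omega

theorem colorableOn_univ_of_large [Finite V] (hA : IsLargestClique G A) (h : AvoidsP3P2 G)
    (hK : AvoidsK1K2Join p G) (hp : p + 2 ≤ A.card) (hp3 : 3 * p ≤ A.card + 1) :
    ColorableOn G Set.univ (A.card + (p - 1)) := by
  classical
  refine (hA.colorableOn_missed_one_union hK hp (D := {x | 2 ≤ (missed G A x).card})
    (fun x hx => hx) (hA.isP3FreeOn_of_card_missed_inter h hK (S := ∅) (by simp) (e := 0)
      (by simpa using hp3) (fun x hx => hx) (by simp))).mono ?_ le_rfl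
  intro x _
  have := Finset.card_pos.2 (hA.missed_nonempty x)
  rcases Nat.lt_or_ge 1 (missed G A x).card with h1 | h1
  · exact Or.inr h1
  · exact Or.inl (by simp only [Set.mem_ofPred_eq]; omega)

theorem colorableOn_univ_of_card_eq [Finite V] (hA : IsLargestClique G A) (h : AvoidsP3P2 G)
    (hK : AvoidsK1K2Join p G) (hp : 2 ≤ p) (hp3 : A.card + 2 = 3 * p) :
    ColorableOn G Set.univ (A.card + (4 * p - 3)) := by
  classical
  obtain ⟨i, hi, j, hj, hij⟩ := Finset.one_lt_card.1 (show 1 < A.card by omega)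
  let D : Set V := {x | 2 ≤ (missed G A x).card ∧ (i ∈ hit G A x ∨ j ∈ hit G A x)}
  have hD : IsP3FreeOn G D := by
    refine hA.isP3FreeOn_of_card_hit h fun a ha b hb c hc => ?_
    have h1 := hA.card_hit_lt hK ha.1
    have h2 := hA.card_hit_lt hK hb.1
    have h3 := hA.card_hit_lt hK hc.1
    have h4 := Finset.card_union_le (hit G A a ∪ hit G A b) (hit G A c)
    have h5 := Finset.card_union_add_card_inter (hit G A a) (hit G A b)
    have h6 := Finset.card_union_add_card_inter (hit G A a ∪ hit G A b) (hit G A c)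
    -- Pigeonhole: two of the three hit the same one of `i` and `j`. The overlap saves the one
    -- vertex lacking when `ω = 3p - 2`.
    have h7 : (hit G A a ∩ hit G A b).Nonempty ∨
        ((hit G A a ∪ hit G A b) ∩ hit G A c).Nonempty := by
      rcases ha.2 with ha | ha <;> rcases hb.2 with hb | hb <;> rcases hc.2 with hc | hc
      all_goals first
        | exact Or.inl ⟨_, Finset.mem_inter.2 ⟨ha, hb⟩⟩
        | exact Or.inr ⟨_, Finset.mem_inter.2 ⟨Finset.mem_union_left _ ha, hc⟩⟩
        | exact Or.inr ⟨_, Finset.mem_inter.2 ⟨Finset.mem_union_right _ hb, hc⟩⟩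
    rcases h7 with h7 | h7 <;> have h8 := Finset.card_pos.2 h7 <;> omega
  have h1 := hA.colorableOn_missed_one_union hK (by omega) (fun x (hx : x ∈ D) => hx.1) hD
  have h2 := hA.colorableOn_both_missed h hi hj hij
    (S := {x | ¬ G.Adj x i ∧ ¬ G.Adj x j}) (fun x hx => hx) fun T _ hTc => hA.card_le T hTc
  refine (h1.union h2).mono ?_ (by omega)
  intro x _
  have := Finset.card_pos.2 (hA.missed_nonempty x)
  by_cases h3 : (missed G A x).card = 1
  · exact Or.inl (Or.inl h3)
  · by_cases h4 : i ∈ hit G A x ∨ j ∈ hit G A x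
    · exact Or.inl (Or.inr ⟨by omega, h4⟩)
    · rw [mem_hit, mem_hit] at h4
      exact Or.inr ⟨fun h => h4 (Or.inl ⟨hi, h⟩), fun h => h4 (Or.inr ⟨hj, h⟩)⟩

theorem colorableOn_univ_sum [Finite V] [Nonempty V] (hA : IsLargestClique G A)
    (h : AvoidsP3P2 G) :
    ColorableOn G Set.univ
      (A.card + ∑ j ∈ Finset.range A.card, j * min A.card (A.card + 1 - j)) := by
  obtain ⟨v, hv, hinj, hsurj⟩ := exists_enumeration A
  refine (hA.colorableOn_missed_one.union (hA.colorableOn_missesTwo h hv hinj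
    fun i _ j _ _ T hT _ => hA.card_le T hT)).mono ?_ le_rfl
  intro x _
  have := Finset.card_pos.2 (hA.missed_nonempty x)
  by_cases h3 : (missed G A x).card = 1
  · exact Or.inl h3
  · right
    obtain ⟨y, hy, z, hz, hyz⟩ := Finset.one_lt_card.1
      (show 1 < (missed G A x).card by omega)
    rw [mem_missed] at hy hz
    obtain ⟨i, hi, rfl⟩ := hsurj y hy.1
    obtain ⟨j, hj, rfl⟩ := hsurj z hz.1
    rcases lt_trichotomy i j with h | rfl | h
    · exact ⟨j, hj, i, h, hy.2, hz.2⟩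
    · exact absurd rfl hyz
    · exact ⟨i, hi, j, h, hz.2, hy.2⟩

/-- A clique `T` of more than `p + 1` vertices that misses two vertices `i` and `j` of `A` forces
the vertices adjacent to exactly one of `i` and `j` to induce a complete multipartite graph. -/
theorem colorableOn_univ_of_card_clique [Finite V] (hA : IsLargestClique G A) (h : AvoidsP3P2 G)
    (hK : AvoidsK1K2Join p G) {i j : V} (hi : i ∈ A) (hj : j ∈ A) (hij : i ≠ j) {T : Finset V}
    (hT : G.IsClique (T : Set V)) (hTp : p + 2 ≤ T.card)
    (hTm : ∀ x ∈ T, ¬ G.Adj x i ∧ ¬ G.Adj x j) {n : ℕ}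
    (hn : ColorableOn G {x | G.Adj x i ∧ G.Adj x j} n) :
    ColorableOn G Set.univ (n + 2 * A.card + 2) := by
  classical
  have hadj : G.Adj i j := hA.isClique hi hj hij
  let O : Set V := {z | z ≠ i ∧ z ≠ j ∧ (G.Adj z i ∧ ¬ G.Adj z j ∨ ¬ G.Adj z i ∧ G.Adj z j)}
  -- The path through `z`, `i`, `j` and an edge of `T` missed by `z` would form `P₃ ∪ P₂`.
  have hO : ∀ z ∈ O, ∀ x ∈ T, ∀ y ∈ T, ¬ G.Adj z x → ¬ G.Adj z y → x = y := by
    rintro z ⟨hzi, hzj, hz⟩ x hx y hy hzx hzy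
    by_contra hxy
    have hx' := hTm x hx
    have hy' := hTm y hy
    rcases hz with hz | hz
    · exact h z i j x y hz.1 hadj hz.2 hzj (hT hx hy hxy) hzx (fun e => hx'.1 e.symm)
        (fun e => hx'.2 e.symm) hzy (fun e => hy'.1 e.symm) (fun e => hy'.2 e.symm)
    · exact h z j i x y hz.2 hadj.symm hz.1 hzi (hT hx hy hxy) hzx (fun e => hx'.2 e.symm)
        (fun e => hx'.1 e.symm) hzy (fun e => hy'.2 e.symm) (fun e => hy'.1 e.symm)
  -- No vertex `z` and edge `ab` outside of `T` see more than `p` common vertices of `T`.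
  have hco : ∀ z a b x, ¬ G.Adj z a → ¬ G.Adj z b → G.Adj a b →
      (∀ l ∈ T.erase x, G.Adj z l ∧ G.Adj a l ∧ G.Adj b l) → False := by
    intro z a b x hza hzb hab hl
    have h1 := Finset.pred_card_le_card_erase (s := T) (a := x)
    obtain ⟨K, hKs, hKc⟩ := Finset.exists_subset_card_eq (show p ≤ (T.erase x).card by omega)
    exact hK z a b K (hT.subset fun l hl => Finset.mem_of_mem_erase (hKs hl)) hKc hza hzb hab
      fun l hlK => hl l (hKs hlK)
  obtain ⟨f, hf1, hf2⟩ := exists_index T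
  have h1 : ColorableOn G {z | z ∈ O ∧ ∃ x ∈ T, ¬ G.Adj z x} T.card := by
    have hm : ∀ z : V, ∃ x, z ∈ O → (∃ x ∈ T, ¬ G.Adj z x) → x ∈ T ∧ ¬ G.Adj z x := by
      intro z
      by_cases hz : ∃ x ∈ T, ¬ G.Adj z x
      · obtain ⟨x, hx⟩ := hz
        exact ⟨x, fun _ _ => hx⟩
      · exact ⟨z, fun _ h => absurd h hz⟩
    choose m hm using hm
    refine ⟨fun z => f (m z), fun z hz => hf1 _ (hm z hz.1 hz.2).1, ?_⟩
    intro y hy z hz hyz he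
    have hmy := hm y hy.1 hy.2
    have hmz := hm z hz.1 hz.2
    have he' := hf2 hmy.1 hmz.1 he
    -- The common missed vertex is the `K₁`, the edge `yz` the `K₂`, and the rest of `T` supplies
    -- the `K_p`.
    refine hco (m y) y z (m y) (fun e => hmy.2 e.symm) (fun e => hmz.2 (he' ▸ e.symm)) hyz
      fun l hl => ?_
    rw [Finset.mem_erase] at hl
    refine ⟨hT hmy.1 hl.2 hl.1.symm, ?_, ?_⟩
    · by_contra hcon
      exact hl.1 (hO y hy.1 l hl.2 (m y) hmy.1 hcon hmy.2)
    · by_contra hcon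
      exact hl.1 (he' ▸ hO z hz.1 l hl.2 (m z) hmz.1 hcon hmz.2)
  have h2 : ColorableOn G {z | z ∈ O ∧ ∀ x ∈ T, G.Adj z x} (A.card - T.card) := by
    refine ColorableOn.of_trans_not_adj ?_ ?_
    · rintro a ⟨-, ha⟩ b ⟨-, hb⟩ c ⟨-, hc⟩ hab hbc hac
      exact hco b a c a (fun e => hab e.symm) hbc hac fun l hl => by
        have hl := Finset.mem_of_mem_erase hl
        exact ⟨hb l hl, ha l hl, hc l hl⟩
    · intro S hS hSc
      have hdisj : Disjoint S T := by
        rw [Finset.disjoint_left]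
        intro x hxS hxT
        exact ((hS hxS).2 x hxT).ne rfl
      have := hA.card_le (S ∪ T) (by
        intro x hx y hy hxy
        rw [Finset.coe_union] at hx hy
        rcases hx with hx | hx <;> rcases hy with hy | hy
        · exact hSc hx hy hxy
        · exact (hS hx).2 y hy
        · exact ((hS hy).2 x hx).symm
        · exact hT hx hy hxy)
      rw [Finset.card_union_of_disjoint hdisj] at this
      omega
  have h3 := hA.colorableOn_both_missed h hi hj hij
    (S := {x | ¬ G.Adj x i ∧ ¬ G.Adj x j}) (fun x hx => hx) fun T _ hTc => hA.card_le T hTc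
  have h4 := (ColorableOn.singleton (G := G) i).union (ColorableOn.singleton j)
  have h5 := hA.card_le T hT
  refine ((hn.union (h1.union h2)).union (h3.union h4)).mono ?_ (by omega)
  intro z _
  by_cases hz : z = i ∨ z = j
  · exact Or.inr (Or.inr hz)
  · rw [not_or] at hz
    by_cases hzi : G.Adj z i <;> by_cases hzj : G.Adj z j
    · exact Or.inl (Or.inl ⟨hzi, hzj⟩)
    · have hzO : z ∈ O := ⟨hz.1, hz.2, Or.inl ⟨hzi, hzj⟩⟩
      by_cases hzT : ∀ x ∈ T, G.Adj z x
      · exact Or.inl (Or.inr (Or.inr ⟨hzO, hzT⟩))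
      · push Not at hzT
        exact Or.inl (Or.inr (Or.inl ⟨hzO, hzT⟩))
    · have hzO : z ∈ O := ⟨hz.1, hz.2, Or.inr ⟨hzi, hzj⟩⟩
      by_cases hzT : ∀ x ∈ T, G.Adj z x
      · exact Or.inl (Or.inr (Or.inr ⟨hzO, hzT⟩))
      · push Not at hzT
        exact Or.inl (Or.inr (Or.inl ⟨hzO, hzT⟩))
    · exact Or.inr (Or.inl ⟨hzi, hzj⟩)

end IsLargestClique

end

/-! ### Arithmetic of the bounds -/

/-- The sum in the bound for cliques of intermediate size. -/
def tailSum (p q : ℕ) : ℕ := ∑ j ∈ Finset.Icc 4 q, (j - 1) * (p + 3 - j)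

/-- The number of colours allowed in addition to `ω` when `ω = p + 2 + k`. -/
def extraColors (p k : ℕ) : ℕ :=
  if 2 * p ≤ k + 3 then p - 1
  else if k + 4 = 2 * p then 4 * p - 3
  else 7 * (p - 1) + tailSum p (p - k / 2)

/-- The closed form, multiplied by 6 to stay in the integers, turns the later comparisons into
polynomial inequalities. -/
theorem six_mul_tailSum {p q : ℕ} (hq : 3 ≤ q) (hqp : q ≤ p + 3) :
    6 * (tailSum p q : ℤ) = q * (q - 1) * (3 * p + 7 - 2 * q) - 6 * (3 * p + 1) := by
  induction q, hq using Nat.le_induction with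
  | base => simp [tailSum]; ring
  | succ q hq ih =>
    have h1 := ih (by omega)
    have h2 : tailSum p (q + 1) = tailSum p q + q * (p + 2 - q) := by
      rw [tailSum, Finset.sum_Icc_succ_top (by omega), tailSum, Nat.add_sub_cancel,
        show p + 3 - (q + 1) = p + 2 - q by omega]
    have h3 : ((p + 2 - q : ℕ) : ℤ) = p + 2 - q := by
      rw [Nat.cast_sub (by omega)]; push_cast; ring
    rw [h2, Nat.cast_add, Nat.cast_mul, h3, mul_add, h1]
    push_cast
    ring

/-- The minimum lowers only the term `j = 1`, from `p + 2` to `p + 1`; this is the extra 6. -/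
theorem six_mul_sum_range {p b : ℕ} (hb : 2 ≤ b) (hbp : b ≤ p + 3) :
    6 * ((∑ j ∈ Finset.range b, j * min (p + 1) (p + 3 - j) : ℕ) : ℤ) + 6 =
      b * (b - 1) * (3 * p + 10 - 2 * b) := by
  induction b, hb using Nat.le_induction with
  | base => simp [Finset.sum_range_succ]; ring
  | succ b hb ih =>
    have h1 := ih (by omega)
    have h2 : min (p + 1) (p + 3 - b) = p + 3 - b := by omega
    have h3 : ((p + 3 - b : ℕ) : ℤ) = p + 3 - b := by
      rw [Nat.cast_sub (by omega)]; push_cast; ring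
    rw [Finset.sum_range_succ, h2, Nat.cast_add, Nat.cast_mul, h3]
    push_cast at h1 ⊢
    linear_combination h1

theorem sum_range_le_sum_Icc {w p : ℕ} (h : w ≤ p + 1) :
    ∑ j ∈ Finset.range w, j * min w (w + 1 - j) ≤
      ∑ j ∈ Finset.Icc 2 (p + 1), (j - 1) * (p + 3 - j) := by
  have h1 : ∑ j ∈ Finset.Icc 2 (p + 1), (j - 1) * (p + 3 - j) =
      ∑ i ∈ Finset.range p, (i + 1) * (p + 1 - i) := by
    rw [← Finset.Ico_add_one_right_eq_Icc, Finset.sum_Ico_eq_sum_range,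
      show p + 1 + 1 - 2 = p by omega]
    refine Finset.sum_congr rfl fun i _ => ?_
    congr 1 <;> omega
  cases w with
  | zero => simp
  | succ w =>
    rw [h1, Finset.sum_range_succ', zero_mul, add_zero]
    refine (Finset.sum_le_sum fun i _ => ?_).trans
      (Finset.sum_le_sum_of_subset (Finset.range_subset_range.2 (show w ≤ p by omega)))
    exact Nat.mul_le_mul_left _ (by omega)

/-- The left side charges `p + 1` colours to each pair inside one of three nearly equal segments of
total length `q + 3`; there are at most `(q + 1)(q + 2) / 6` such pairs. -/
theorem mul_sum_three_le {p q : ℕ} (hq : 3 ≤ q) (hqp : q ≤ p) :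
    (p + 1) * (∑ j ∈ Finset.range ((q + 3) / 3), j) + (p + 1) * (∑ j ∈ Finset.range ((q + 4) / 3), j)
      + (p + 1) * (∑ j ∈ Finset.range ((q + 5) / 3), j) ≤ 6 * (p - 1) + tailSum p q := by
  have hr : ∀ b : ℕ, (((∑ j ∈ Finset.range (b + 1), j : ℕ) : ℤ)) * 2 = (b + 1) * b := by
    intro b
    have := Finset.sum_range_id_mul_two (b + 1)
    exact_mod_cast this
  have h6 := six_mul_tailSum hq (p := p) (by omega)
  have hC : 6 * ((∑ j ∈ Finset.range ((q + 3) / 3), j) + (∑ j ∈ Finset.range ((q + 4) / 3), j)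
      + (∑ j ∈ Finset.range ((q + 5) / 3), j) : ℤ) ≤ (q + 1) * (q + 2) := by
    obtain ⟨t, ht⟩ : ∃ t, t = q / 3 := ⟨_, rfl⟩
    have h1 := hr t
    have h2 := hr (t + 1)
    push_cast at h1 h2
    have hcases : q = 3 * t ∨ q = 3 * t + 1 ∨ q = 3 * t + 2 := by omega
    rcases hcases with rfl | rfl | rfl
    · rw [show (3 * t + 3) / 3 = t + 1 by omega, show (3 * t + 4) / 3 = t + 1 by omega,
        show (3 * t + 5) / 3 = t + 1 by omega]
      push_cast
      nlinarith
    · rw [show (3 * t + 1 + 3) / 3 = t + 1 by omega, show (3 * t + 1 + 4) / 3 = t + 1 by omega,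
        show (3 * t + 1 + 5) / 3 = t + 1 + 1 by omega]
      push_cast
      nlinarith
    · rw [show (3 * t + 2 + 3) / 3 = t + 1 by omega, show (3 * t + 2 + 4) / 3 = t + 1 + 1 by omega,
        show (3 * t + 2 + 5) / 3 = t + 1 + 1 by omega]
      push_cast
      nlinarith
  -- For `q = 3` the estimate `hC` is too weak and the exact count of three pairs is needed.
  rcases hq.eq_or_lt with rfl | hq4
  · simp [Finset.sum_range_succ]
    omega
  · rw [← mul_add, ← mul_add]
    generalize (∑ j ∈ Finset.range ((q + 3) / 3), j) = c₁ at hC ⊢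
    generalize (∑ j ∈ Finset.range ((q + 4) / 3), j) = c₂ at hC ⊢
    generalize (∑ j ∈ Finset.range ((q + 5) / 3), j) = c₃ at hC ⊢
    zify [show 1 ≤ p by omega]
    have h4 : (4 : ℤ) ≤ q := by exact_mod_cast hq4
    have h5 : (q : ℤ) ≤ p := by exact_mod_cast hqp
    have h7 := mul_le_mul_of_nonneg_left hC (show (0 : ℤ) ≤ p + 1 by positivity)
    have h8 : ((p : ℤ) + 1) * ((q + 1) * (q + 2)) + 6 ≤ 36 * (p - 1) +
        (q * (q - 1) * (3 * p + 7 - 2 * q) - 6 * (3 * p + 1)) + 6 := by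
      -- The first factor is the coefficient of `p` in the difference of the two sides, so this
      -- reduces to `p = q`, where `2q² + 6q - 44 ≥ 0` remains, up to the 6 on both sides.
      have h9 : (0 : ℤ) ≤ (2 * q ^ 2 - 6 * q + 16) * (p - q) :=
        mul_nonneg (by nlinarith) (by linarith)
      nlinarith
    linarith

theorem sum_halves_le {p : ℕ} (hp : 4 ≤ p) :
    (∑ j ∈ Finset.range ((p + 2) / 2), j * min (p + 1) (p + 3 - j)) +
      (∑ j ∈ Finset.range ((p + 3) / 2), j * min (p + 1) (p + 3 - j)) ≤
      7 * (p - 1) + tailSum p p := by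
  have h6 := six_mul_tailSum (p := p) (q := p) (by omega) (by omega)
  obtain ⟨b₁, hb₁⟩ : ∃ b, b = (p + 2) / 2 := ⟨_, rfl⟩
  obtain ⟨b₂, hb₂⟩ : ∃ b, b = (p + 3) / 2 := ⟨_, rfl⟩
  rw [← hb₁, ← hb₂]
  have h1 := six_mul_sum_range (p := p) (b := b₁) (by omega) (by omega)
  have h2 := six_mul_sum_range (p := p) (b := b₂) (by omega) (by omega)
  generalize (∑ j ∈ Finset.range b₁, j * min (p + 1) (p + 3 - j)) = c₁ at h1 ⊢
  generalize (∑ j ∈ Finset.range b₂, j * min (p + 1) (p + 3 - j)) = c₂ at h2 ⊢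
  zify [show 1 ≤ p by omega]
  obtain ⟨t, ht⟩ : ∃ t, t = p / 2 := ⟨_, rfl⟩
  have h2t : 2 ≤ t := by omega
  have h2t' : (2 : ℤ) ≤ t := by exact_mod_cast h2t
  obtain rfl : b₁ = t + 1 := by omega
  have hcases : p = 2 * t ∨ p = 2 * t + 1 := by omega
  rcases hcases with rfl | rfl
  · obtain rfl : b₂ = t + 1 := by omega
    push_cast at *
    nlinarith
  · obtain rfl : b₂ = t + 2 := by omega
    push_cast at *
    nlinarith

/-- This pays for the induction step: with `ω = p + 2 + k`, passing to the common neighbourhood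
lowers `p` by 2, keeps `k`, and costs `2ω` beyond the allowance. -/
theorem extraColors_sub_two {p k : ℕ} (hp : 3 ≤ p) (hk : k + 5 ≤ 2 * p) :
    2 * (p + 2 + k) + extraColors (p - 2) k ≤ extraColors p k := by
  have he : extraColors p k = 7 * (p - 1) + tailSum p (p - k / 2) := by
    rw [extraColors, if_neg (by omega), if_neg (by omega)]
  rw [he]
  by_cases h1 : 2 * p ≤ k + 7
  · rw [extraColors, if_pos (by omega)]
    omega
  by_cases h2 : 2 * p = k + 8
  · rw [extraColors, if_neg (by omega), if_pos (by omega), show p - k / 2 = 4 by omega]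
    simp only [tailSum, Finset.Icc_self, Finset.sum_singleton]
    omega
  rw [extraColors, if_neg (by omega), if_neg (by omega)]
  obtain ⟨q, hq⟩ : ∃ q, q = p - k / 2 - 2 := ⟨_, rfl⟩
  obtain ⟨r, rfl⟩ : ∃ r, p = r + 2 := ⟨p - 2, by omega⟩
  have h3 := six_mul_tailSum (p := r) (q := q) (by omega) (by omega)
  have h4 := six_mul_tailSum (p := r + 2) (q := q + 2) (by omega) (by omega)
  rw [show r + 2 - k / 2 = q + 2 by omega, show r + 2 - 2 - k / 2 = q by omega, Nat.add_sub_cancel]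
  have h5 : (3 : ℤ) ≤ q := by exact_mod_cast (show 3 ≤ q by omega)
  have h6 : (q : ℤ) ≤ r := by exact_mod_cast (show q ≤ r by omega)
  have h7 : (k : ℤ) ≤ 2 * (r - q) + 1 := by
    have : k + 2 * q ≤ 2 * r + 1 := by omega
    have : (k : ℤ) + 2 * q ≤ 2 * r + 1 := by exact_mod_cast this
    linarith
  have h8 : 1 ≤ r := by omega
  zify [show 1 ≤ r + 2 by omega, h8]
  push_cast at h4
  nlinarith [mul_nonneg (sub_nonneg.2 h5) (sub_nonneg.2 h6)]

/-! ### Intermediate clique sizes -/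

namespace IsLargestClique

variable {V : Type*} {G : SimpleGraph V} {A : Finset V} {p : ℕ}

theorem colorableOn_missesTwo_segment [Finite V] (hA : IsLargestClique G A) (h : AvoidsP3P2 G)
    {v : ℕ → V} (hv : ∀ i < A.card, v i ∈ A) (hinj : Set.InjOn v (Set.Iio A.card)) {a b m : ℕ}
    (hab : a + b ≤ A.card)
    (hm : ∀ i ∈ A, ∀ j ∈ A, i ≠ j → ∀ T : Finset V, G.IsClique (T : Set V) →
      (∀ x ∈ T, ¬ G.Adj x i ∧ ¬ G.Adj x j) → T.card ≤ m) :
    ColorableOn G (missesTwo G (fun l => v (a + l)) b)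
      (∑ j ∈ Finset.range b, j * min m (A.card + 1 - j)) := by
  refine hA.colorableOn_missesTwo h (fun l hl => hv _ (by omega)) ?_ hm
  intro i hi j hj hij
  have hi' : i < b := hi
  have hj' : j < b := hj
  have := hinj (show a + i < A.card by omega) (show a + j < A.card by omega) hij
  omega

theorem colorableOn_missesTwo_segment_mul [Finite V] (hA : IsLargestClique G A)
    (h : AvoidsP3P2 G) {v : ℕ → V} (hv : ∀ i < A.card, v i ∈ A)
    (hinj : Set.InjOn v (Set.Iio A.card)) {a b m : ℕ} (hab : a + b ≤ A.card)
    (hm : ∀ i ∈ A, ∀ j ∈ A, i ≠ j → ∀ T : Finset V, G.IsClique (T : Set V) →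
      (∀ x ∈ T, ¬ G.Adj x i ∧ ¬ G.Adj x j) → T.card ≤ m) :
    ColorableOn G (missesTwo G (fun l => v (a + l)) b) (m * ∑ j ∈ Finset.range b, j) := by
  refine (hA.colorableOn_missesTwo_segment h hv hinj hab hm).mono subset_rfl ?_
  rw [Finset.mul_sum]
  refine Finset.sum_le_sum fun j _ => ?_
  rw [mul_comm m]
  exact Nat.mul_le_mul_left _ (min_le_left _ _)

/-- Three segments of the clique cover enough of it for the vertices that miss at most one vertex
of each segment to induce a `P₃`-free graph. -/
theorem colorableOn_univ_three_segments [Finite V] [Nonempty V] (hA : IsLargestClique G A)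
    (h : AvoidsP3P2 G) (hK : AvoidsK1K2Join p G) {k : ℕ} (hk : 1 ≤ k) (hkp : k + 5 ≤ 2 * p)
    (hcard : A.card = p + 2 + k)
    (hm : ∀ i ∈ A, ∀ j ∈ A, i ≠ j → ∀ T : Finset V, G.IsClique (T : Set V) →
      (∀ x ∈ T, ¬ G.Adj x i ∧ ¬ G.Adj x j) → T.card ≤ p + 1) :
    ColorableOn G Set.univ (A.card + (7 * (p - 1) + tailSum p (p - k / 2))) := by
  classical
  obtain ⟨v, hv, hinj, -⟩ := exists_enumeration A
  obtain ⟨q, hq⟩ : ∃ q, q = p - k / 2 := ⟨_, rfl⟩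
  rw [← hq]
  -- The three lengths sum to `q + 3 = p - ⌊k/2⌋ + 3`, which fits into `A` because `k ≥ 1`.
  obtain ⟨b₁, hb₁⟩ : ∃ b, b = (q + 3) / 3 := ⟨_, rfl⟩
  obtain ⟨b₂, hb₂⟩ : ∃ b, b = (q + 4) / 3 := ⟨_, rfl⟩
  obtain ⟨b₃, hb₃⟩ : ∃ b, b = (q + 5) / 3 := ⟨_, rfl⟩
  have h1 := hA.colorableOn_missesTwo_segment_mul h hv hinj (a := 0) (b := b₁) (by omega) hm
  have h2 := hA.colorableOn_missesTwo_segment_mul h hv hinj (a := b₁) (b := b₂) (by omega) hm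
  have h3 := hA.colorableOn_missesTwo_segment_mul h hv hinj (a := b₁ + b₂) (b := b₃) (by omega) hm
  let D : Set V := {x | 2 ≤ (missed G A x).card ∧ x ∉ missesTwo G (fun l => v (0 + l)) b₁ ∧
    x ∉ missesTwo G (fun l => v (b₁ + l)) b₂ ∧ x ∉ missesTwo G (fun l => v (b₁ + b₂ + l)) b₃}
  let S : Finset V := (Finset.range (q + 3)).image v
  have hS : S ⊆ A := by
    intro y hy
    obtain ⟨l, hl, rfl⟩ := Finset.mem_image.1 hy
    exact hv l (by have := Finset.mem_range.1 hl; omega)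
  have hScard : S.card = q + 3 := by
    rw [Finset.card_image_of_injOn, Finset.card_range]
    refine hinj.mono fun l hl => ?_
    have : l < q + 3 := by simpa using hl
    simp only [Set.mem_Iio]
    omega
  have hD : IsP3FreeOn G D := by
    -- One missed vertex per segment gives `e = 3`; the cardinality condition becomes `2p ≤ k + 2q`,
    -- which explains the choice of `q`.
    refine hA.isP3FreeOn_of_card_missed_inter h hK hS (e := 3) (by omega) (fun x hx => hx.1) ?_
    rintro x ⟨-, hx1, hx2, hx3⟩
    have h4 := card_missed_inter_le_one (A := A) hx1
    have h5 := card_missed_inter_le_one (A := A) hx2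
    have h6 := card_missed_inter_le_one (A := A) hx3
    have hsub : missed G A x ∩ S ⊆
        missed G A x ∩ (Finset.range b₁).image (fun l => v (0 + l)) ∪
        missed G A x ∩ (Finset.range b₂).image (fun l => v (b₁ + l)) ∪
        missed G A x ∩ (Finset.range b₃).image (fun l => v (b₁ + b₂ + l)) := by
      intro y hy
      rw [Finset.mem_inter] at hy
      obtain ⟨l, hl, rfl⟩ := Finset.mem_image.1 hy.2
      rw [Finset.mem_range] at hl
      rw [Finset.mem_union, Finset.mem_union]
      rcases lt_or_ge l b₁ with h7 | h7
      · exact Or.inl (Or.inl (Finset.mem_inter.2 ⟨hy.1, Finset.mem_image.2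
          ⟨l, Finset.mem_range.2 h7, by rw [zero_add]⟩⟩))
      rcases lt_or_ge l (b₁ + b₂) with h8 | h8
      · exact Or.inl (Or.inr (Finset.mem_inter.2 ⟨hy.1, Finset.mem_image.2
          ⟨l - b₁, Finset.mem_range.2 (by omega), by rw [Nat.add_sub_cancel' h7]⟩⟩))
      · exact Or.inr (Finset.mem_inter.2 ⟨hy.1, Finset.mem_image.2
          ⟨l - (b₁ + b₂), Finset.mem_range.2 (by omega), by rw [Nat.add_sub_cancel' h8]⟩⟩)
    refine (Finset.card_le_card hsub).trans ((Finset.card_union_le _ _).trans ?_)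
    refine (Nat.add_le_add_right (Finset.card_union_le _ _) _).trans ?_
    omega
  have h4 := hA.colorableOn_missed_one_union hK (by omega) (fun x (hx : x ∈ D) => hx.1) hD
  have h5 := mul_sum_three_le (p := p) (q := q) (by omega) (by omega)
  rw [← hb₁, ← hb₂, ← hb₃] at h5
  refine (((h1.union h2).union h3).union h4).mono ?_ (by omega)
  intro x _
  have h6 := Finset.card_pos.2 (hA.missed_nonempty x)
  by_contra hx
  simp only [Set.mem_union, not_or] at hx
  have h7 : (missed G A x).card ≠ 1 := hx.2.1
  exact hx.2.2 ⟨by omega, hx.1.1.1, hx.1.1.2, hx.1.2⟩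

/-- If `ω = p + 2`, a vertex missing two vertices of the clique misses at least three of them, so
two of them lie in the same half of the clique. -/
theorem colorableOn_univ_two_segments [Finite V] [Nonempty V] (hA : IsLargestClique G A)
    (h : AvoidsP3P2 G) (hK : AvoidsK1K2Join p G) (hp : 4 ≤ p) (hcard : A.card = p + 2)
    (hm : ∀ i ∈ A, ∀ j ∈ A, i ≠ j → ∀ T : Finset V, G.IsClique (T : Set V) →
      (∀ x ∈ T, ¬ G.Adj x i ∧ ¬ G.Adj x j) → T.card ≤ p + 1) :
    ColorableOn G Set.univ (A.card + (7 * (p - 1) + tailSum p p)) := by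
  classical
  obtain ⟨v, hv, hinj, hsurj⟩ := exists_enumeration A
  obtain ⟨b₁, hb₁⟩ : ∃ b, b = (p + 2) / 2 := ⟨_, rfl⟩
  obtain ⟨b₂, hb₂⟩ : ∃ b, b = (p + 3) / 2 := ⟨_, rfl⟩
  have h1 := hA.colorableOn_missesTwo_segment h hv hinj (a := 0) (b := b₁) (by omega) hm
  have h2 := hA.colorableOn_missesTwo_segment h hv hinj (a := b₁) (b := b₂) (by omega) hm
  have h3 := sum_halves_le hp
  rw [← hb₁, ← hb₂] at h3
  rw [show A.card + 1 = p + 3 by omega] at h1 h2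
  refine (hA.colorableOn_missed_one.union (h1.union h2)).mono ?_ (by omega)
  intro x _
  have h4 := Finset.card_pos.2 (hA.missed_nonempty x)
  by_contra hx
  simp only [Set.mem_union, not_or] at hx
  have h5 : (missed G A x).card ≠ 1 := hx.1
  have h6 := card_missed_inter_le_one (A := A) hx.2.1
  have h7 := card_missed_inter_le_one (A := A) hx.2.2
  have h8 := hA.card_hit_lt hK (x := x) (by omega)
  have h9 := card_hit_add_card_missed (G := G) (A := A) x
  have hsub : missed G A x ⊆
      missed G A x ∩ (Finset.range b₁).image (fun l => v (0 + l)) ∪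
      missed G A x ∩ (Finset.range b₂).image (fun l => v (b₁ + l)) := by
    intro y hy
    obtain ⟨l, hl, rfl⟩ := hsurj y (mem_missed.1 hy).1
    rw [Finset.mem_union]
    rcases lt_or_ge l b₁ with h7 | h7
    · exact Or.inl (Finset.mem_inter.2 ⟨hy, Finset.mem_image.2
        ⟨l, Finset.mem_range.2 h7, by rw [zero_add]⟩⟩)
    · exact Or.inr (Finset.mem_inter.2 ⟨hy, Finset.mem_image.2
        ⟨l - b₁, Finset.mem_range.2 (by omega), by rw [Nat.add_sub_cancel' h7]⟩⟩)
  have h10 := (Finset.card_le_card hsub).trans (Finset.card_union_le _ _)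
  omega

/-- The case `p = 3`, `k = 0`. One segment of three vertices suffices: its pairs cost `4 + 2 * 4 =
12` colours and the `P₃`-free rest `p - 1 = 2`. -/
theorem colorableOn_univ_of_card_eq_five [Finite V] [Nonempty V] (hA : IsLargestClique G A)
    (h : AvoidsP3P2 G) (hK : AvoidsK1K2Join 3 G) (hcard : A.card = 5)
    (hm : ∀ i ∈ A, ∀ j ∈ A, i ≠ j → ∀ T : Finset V, G.IsClique (T : Set V) →
      (∀ x ∈ T, ¬ G.Adj x i ∧ ¬ G.Adj x j) → T.card ≤ 4) :
    ColorableOn G Set.univ (A.card + 14) := by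
  classical
  obtain ⟨v, hv, hinj, -⟩ := exists_enumeration A
  have h1 := hA.colorableOn_missesTwo (b := 3) h (fun l hl => hv l (by omega))
    (hinj.mono (Set.Iio_subset_Iio (by omega))) hm
  let D : Set V := {x | 2 ≤ (missed G A x).card ∧ x ∉ missesTwo G v 3}
  have hD : IsP3FreeOn G D := by
    refine hA.isP3FreeOn_of_card_missed_inter h hK (S := (Finset.range 3).image v) (e := 1)
      ?_ ?_ (fun x hx => hx.1) fun x hx => card_missed_inter_le_one hx.2
    · intro y hy
      obtain ⟨l, hl, rfl⟩ := Finset.mem_image.1 hy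
      exact hv l (by have := Finset.mem_range.1 hl; omega)
    · rw [Finset.card_image_of_injOn, Finset.card_range, hcard]
      refine hinj.mono fun l hl => ?_
      have : l < 3 := by simpa using hl
      simp only [Set.mem_Iio]
      omega
  have h2 := hA.colorableOn_missed_one_union hK (by omega) (fun x (hx : x ∈ D) => hx.1) hD
  refine (h1.union h2).mono ?_ (by simp [Finset.sum_range_succ, hcard])
  intro x _
  have h6 := Finset.card_pos.2 (hA.missed_nonempty x)
  by_contra hx
  simp only [Set.mem_union, not_or] at hx
  have h7 : (missed G A x).card ≠ 1 := hx.2.1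
  exact hx.2.2 ⟨by omega, hx.1⟩

/-- Deleting two vertices of a largest clique gives a largest clique in their common
neighbourhood. -/
theorem exists_induce (hA : IsLargestClique G A) (h : AvoidsP3P2 G) (hp : 2 ≤ p)
    (hK : AvoidsK1K2Join p G) {i j : V} (hi : i ∈ A) (hj : j ∈ A) (hij : i ≠ j) :
    ∃ B : Finset {x | G.Adj x i ∧ G.Adj x j}, B.card + 2 = A.card ∧
      IsLargestClique (G.induce {x | G.Adj x i ∧ G.Adj x j}) B ∧
      AvoidsP3P2 (G.induce {x | G.Adj x i ∧ G.Adj x j}) ∧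
      AvoidsK1K2Join (p - 2) (G.induce {x | G.Adj x i ∧ G.Adj x j}) := by
  classical
  have hadj : G.Adj i j := hA.isClique hi hj hij
  -- A clique in the common neighbourhood extends by `i` and `j`.
  have hext : ∀ K : Finset {x | G.Adj x i ∧ G.Adj x j},
      (G.induce {x | G.Adj x i ∧ G.Adj x j}).IsClique (K : Set _) →
      G.IsClique (insert i (insert j (K.map (Function.Embedding.subtype _))) : Finset V) ∧
      (insert i (insert j (K.map (Function.Embedding.subtype _))) : Finset V).card
        = K.card + 2 := by
    intro K hKc
    have hmem : ∀ y ∈ K.map (Function.Embedding.subtype _), G.Adj y i ∧ G.Adj y j := by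
      intro y hy
      obtain ⟨z, -, rfl⟩ := Finset.mem_map.1 hy
      exact z.2
    have hj' : j ∉ K.map (Function.Embedding.subtype _) := fun hy => (hmem j hy).2.ne rfl
    have hi' : i ∉ insert j (K.map (Function.Embedding.subtype _)) := by
      rw [Finset.mem_insert, not_or]
      exact ⟨hij, fun hy => (hmem i hy).1.ne rfl⟩
    constructor
    · rw [Finset.coe_insert, SimpleGraph.isClique_insert, Finset.coe_insert,
        SimpleGraph.isClique_insert]
      refine ⟨⟨?_, fun y hy _ => (hmem y (Finset.mem_coe.1 hy)).2.symm⟩, ?_⟩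
      · intro y hy z hz hyz
        obtain ⟨y, hyK, rfl⟩ := Finset.mem_map.1 (Finset.mem_coe.1 hy)
        obtain ⟨z, hzK, rfl⟩ := Finset.mem_map.1 (Finset.mem_coe.1 hz)
        exact hKc hyK hzK fun he => hyz (by rw [he])
      · rintro y (rfl | hy) _
        · exact hadj
        · exact (hmem y (Finset.mem_coe.1 hy)).1.symm
    · rw [Finset.card_insert_of_notMem hi', Finset.card_insert_of_notMem hj', Finset.card_map]
  have hBcard : (((A.erase i).erase j).subtype (· ∈ {x | G.Adj x i ∧ G.Adj x j})).card + 2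
      = A.card := by
    rw [Finset.card_subtype, Finset.filter_true_of_mem, Finset.card_erase_of_mem,
      Finset.card_erase_of_mem hi]
    · have := Finset.one_lt_card.2 ⟨i, hi, j, hj, hij⟩
      omega
    · exact Finset.mem_erase.2 ⟨hij.symm, hj⟩
    · intro y hy
      rw [Finset.mem_erase, Finset.mem_erase] at hy
      exact ⟨hA.isClique hy.2.2 hi hy.2.1, hA.isClique hy.2.2 hj hy.1⟩
  refine ⟨((A.erase i).erase j).subtype (· ∈ {x | G.Adj x i ∧ G.Adj x j}), hBcard,
    ⟨?_, fun K hKc => ?_⟩, ?_, ?_⟩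
  · intro y hy z hz hyz
    rw [Finset.mem_coe, Finset.mem_subtype, Finset.mem_erase, Finset.mem_erase] at hy hz
    exact hA.isClique hy.2.2 hz.2.2 fun he => hyz (Subtype.ext he)
  · have h1 := hext K hKc
    have h2 := hA.card_le _ h1.1
    omega
  · intro a b c d e hab hbc hac hne
    exact h a b c d e hab hbc hac fun he => hne (Subtype.ext he)
  · intro x y z K hKc hKcard hxy hxz hyz hl
    obtain ⟨h1, h2⟩ := hext K hKc
    refine hK x y z _ h1 (by omega) hxy hxz hyz fun l hlK => ?_
    rw [Finset.mem_insert, Finset.mem_insert] at hlK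
    rcases hlK with rfl | rfl | hlK
    · exact ⟨x.2.1, y.2.1, z.2.1⟩
    · exact ⟨x.2.2, y.2.2, z.2.2⟩
    · obtain ⟨l, hl', rfl⟩ := Finset.mem_map.1 hlK
      exact hl l hl'

end IsLargestClique

/-- Strong induction on `p` with `k` fixed. Starting at `p = 1` rather than 2 lets the step from `p
= 3` land inside the range. -/
theorem colorableOn_univ_extraColors (p k : ℕ) (hp : 1 ≤ p) (V : Type u) [Finite V]
    (G : SimpleGraph V) (h : AvoidsP3P2 G) (hK : AvoidsK1K2Join p G) (A : Finset V)
    (hA : IsLargestClique G A) (hcard : A.card = p + 2 + k) :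
    ColorableOn G Set.univ (A.card + extraColors p k) := by
  induction p using Nat.strong_induction_on generalizing V with
  | _ p ih =>
  by_cases h1 : 2 * p ≤ k + 3
  · rw [extraColors, if_pos h1]
    exact hA.colorableOn_univ_of_large h hK (by omega) (by omega)
  by_cases h2 : k + 4 = 2 * p
  · rw [extraColors, if_neg h1, if_pos h2]
    exact hA.colorableOn_univ_of_card_eq h hK (by omega) (by omega)
  by_cases hbig : ∃ i ∈ A, ∃ j ∈ A, i ≠ j ∧ ∃ T : Finset V, G.IsClique (T : Set V) ∧
      (∀ x ∈ T, ¬ G.Adj x i ∧ ¬ G.Adj x j) ∧ p + 2 ≤ T.card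
  · obtain ⟨i, hi, j, hj, hij, T, hT, hTm, hTp⟩ := hbig
    obtain ⟨B, hBcard, hB, hBP, hBK⟩ := hA.exists_induce h (by omega) hK hi hj hij
    have h3 := ih (p - 2) (by omega) (by omega) _ _ hBP hBK B hB (by omega)
    have h4 := hA.colorableOn_univ_of_card_clique h hK hi hj hij hT hTp hTm
      (ColorableOn.of_induce h3.colorable)
    have h5 := extraColors_sub_two (p := p) (k := k) (by omega) (by omega)
    exact h4.mono subset_rfl (by omega)
  · have hm : ∀ i ∈ A, ∀ j ∈ A, i ≠ j → ∀ T : Finset V, G.IsClique (T : Set V) →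
        (∀ x ∈ T, ¬ G.Adj x i ∧ ¬ G.Adj x j) → T.card ≤ p + 1 := by
      intro i hi j hj hij T hT hTm
      by_contra hc
      exact hbig ⟨i, hi, j, hj, hij, T, hT, hTm, by omega⟩
    obtain ⟨a, -⟩ := Finset.card_pos.1 (show 0 < A.card by omega)
    have : Nonempty V := ⟨a⟩
    rw [extraColors, if_neg h1, if_neg h2]
    rcases Nat.eq_zero_or_pos k with rfl | hk
    · rcases Nat.lt_or_ge p 4 with hp4 | hp4
      · obtain rfl : p = 3 := by omega
        exact hA.colorableOn_univ_of_card_eq_five h hK hcard hm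
      · exact hA.colorableOn_univ_two_segments h hK hp4 hcard hm
    · exact hA.colorableOn_univ_three_segments h hK hk (by omega) hcard hm

/-! ### The theorem -/

theorem exists_isLargestClique {V : Type*} [Finite V] (G : SimpleGraph V) :
    ∃ A : Finset V, IsLargestClique G A ∧ A.card = G.cliqueNum := by
  obtain ⟨A, hA⟩ := G.exists_isNClique_cliqueNum
  exact ⟨A, ⟨hA.isClique, fun K hK => (SimpleGraph.IsClique.card_le_cliqueNum (tc := hK)).trans
    hA.card_eq.ge⟩, hA.card_eq⟩

/-- The classes of `{P₃ ∪ P₂, (K₁ ∪ K₂) + K_p}`-free graphs are linearly `χ`-bounded. -/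
theorem theorem3p5 (p : ℕ) (hp : 2 ≤ p) :
    (∃ a b : ℕ, ∀ (V : Type u) [Finite V] (G : SimpleGraph V), IsP3P2K1K2JoinKFree p G →
      G.chromaticNumber ≤ ((a * G.cliqueNum + b : ℕ) : ℕ∞)) ∧
    ∀ (V : Type u) [Finite V] (G : SimpleGraph V), IsP3P2K1K2JoinKFree p G →
      (3 ≤ G.cliqueNum → G.cliqueNum ≤ p + 1 →
        G.chromaticNumber ≤
          ((G.cliqueNum + ∑ j ∈ Finset.Icc 2 (p + 1), (j - 1) * (p + 3 - j) : ℕ) : ℕ∞)) ∧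
      (∀ k : ℕ, k + 5 ≤ 2 * p → G.cliqueNum = p + 2 + k →
        G.chromaticNumber ≤
          ((G.cliqueNum + 7 * (p - 1)
            + ∑ j ∈ Finset.Icc 4 (p - k / 2), (j - 1) * (p + 3 - j) : ℕ) : ℕ∞)) ∧
      (G.cliqueNum = 3 * p - 2 →
        G.chromaticNumber ≤ ((G.cliqueNum + (4 * p - 3) : ℕ) : ℕ∞)) ∧
      (3 * p - 1 ≤ G.cliqueNum →
        G.chromaticNumber ≤ ((G.cliqueNum + (p - 1) : ℕ) : ℕ∞)) := by
  have hsmall : ∀ (V : Type u) [Finite V] (G : SimpleGraph V), IsP3P2K1K2JoinKFree p G →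
      G.cliqueNum ≤ p + 1 → G.chromaticNumber ≤
        ((G.cliqueNum + ∑ j ∈ Finset.Icc 2 (p + 1), (j - 1) * (p + 3 - j) : ℕ) : ℕ∞) := by
    intro V _ G hG hw
    obtain ⟨A, hA, hAw⟩ := exists_isLargestClique G
    rw [← hAw] at hw ⊢
    refine (ColorableOn.colorable ?_).chromaticNumber_le
    rcases isEmpty_or_nonempty V with hV | hV
    · exact (ColorableOn.empty _).mono (fun x => (hV.false x).elim) le_rfl
    · exact (hA.colorableOn_univ_sum (avoidsP3P2_of_not_isIndContained hG.1)).mono subset_rfl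
        (Nat.add_le_add_left (sum_range_le_sum_Icc hw) _)
  have hlarge : ∀ (V : Type u) [Finite V] (G : SimpleGraph V), IsP3P2K1K2JoinKFree p G →
      ∀ k, G.cliqueNum = p + 2 + k →
        G.chromaticNumber ≤ ((G.cliqueNum + extraColors p k : ℕ) : ℕ∞) := by
    intro V _ G hG k hw
    obtain ⟨A, hA, hAw⟩ := exists_isLargestClique G
    rw [← hAw] at hw ⊢
    exact (colorableOn_univ_extraColors p k (by omega) V G
      (avoidsP3P2_of_not_isIndContained hG.1) (avoidsK1K2Join_of_not_isIndContained hG.2)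
      A hA hw).colorable.chromaticNumber_le
  -- Every bound is `ω` plus a quantity bounded in terms of `p`, so slope 1 works; the constant adds
  -- up the worst cases.
  refine ⟨⟨1, (∑ j ∈ Finset.Icc 2 (p + 1), (j - 1) * (p + 3 - j)) + 7 * (p - 1) + tailSum p p
    + 4 * p, fun V _ G hG => ?_⟩, fun V _ G hG => ⟨fun _ => hsmall V G hG, ?_, ?_, ?_⟩⟩
  · rcases Nat.lt_or_ge (p + 1) G.cliqueNum with hw | hw
    · obtain ⟨k, hk⟩ := Nat.exists_eq_add_of_le (show p + 2 ≤ G.cliqueNum from hw)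
      refine (hlarge V G hG k hk).trans (Nat.cast_le.2 ?_)
      have h1 : tailSum p (p - k / 2) ≤ tailSum p p :=
        Finset.sum_le_sum_of_subset (Finset.Icc_subset_Icc le_rfl (by omega))
      rw [extraColors]
      split_ifs <;> omega
    · exact (hsmall V G hG hw).trans (Nat.cast_le.2 (by omega))
  · intro k hk hw
    have h1 := hlarge V G hG k hw
    rwa [extraColors, if_neg (by omega), if_neg (by omega), ← add_assoc] at h1
  · intro hw
    -- `3p - 2 = p + 2 + (2p - 4)`.
    have h1 := hlarge V G hG (2 * p - 4) (by omega)
    rwa [extraColors, if_neg (by omega), if_pos (by omega)] at h1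
  · intro hw
    obtain ⟨k, hk⟩ := Nat.exists_eq_add_of_le (show p + 2 ≤ G.cliqueNum by omega)
    have h1 := hlarge V G hG k hk
    rwa [extraColors, if_pos (by omega)] at h1
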